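/- Let $G$ be a group and let $F \leq \mathrm{Aut}(G)$ be a finite subgroup. For (not necessarily finite) generating sets $X, Y$ of a group $H$, write $X \preceq Y$ if $\sup_{y \in Y} \|y\|_X < \infty$, where $\|\cdot\|_X$ is the word length with respect to $X$. Let $\mathcal{H}(H)$ be the poset of hyperbolic structures of $H$: the set of all generating sets $X$ of $H$ such that the Cayley graph $\mathrm{Cayl}(H,X)$ is Gromov-hyperbolic, modulo the equivalence relation ($X \preceq Y$ and $Y \preceq X$), with the partial order induced by $\preceq$; the class of $X$ is denoted $[X]$. The label of $[X]$ is the type of the action of $H$ on $\mathrm{Cayl}(H,X)$: bounded (elliptic) if orbits are bounded; horocyclic if it is unbounded without loxodromic elements; lineal if there is a loxodromic element and all loxodromic elements have the same endpoints at infinity; focal if there is a loxodromic element, the action is not lineal, and any two loxodromic elements have a common endpoint at infinity; of general type if there are two loxodromic elements with no common endpoint. The label does not depend on the representative $X$ of $[X]$. The group $\mathrm{Aut}(G)$ acts on $\mathcal{H}(G)$ by $\varphi \ast [X] = [\varphi(X)]$. Let $\mathcal{H}^F(G) \subseteq \mathcal{H}(G)$ be the subposet of the hyperbolic structures $\mathscr{X}$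 that are $F$-invariant, i.e. $\varphi \ast \mathscr{X} = \mathscr{X}$ for every $\varphi \in F$. Then for every hyperbolic generating set $X$ of $G$ with $[X] \in \mathcal{H}^F(G)$, the generating set $X \cup F$ of $G \rtimes F$ has a hyperbolic Cayley graph, and the map $$\Psi : \mathcal{H}^F(G) \to \mathcal{H}(G \rtimes F), \qquad [X] \mapsto [X \cup F]$$ is well defined and is an isomorphism of posets which preserves labels: $[X]$ and $\Psi([X])$ have the same label for every $[X] \in \mathcal{H}^F(G)$. -/

import Mathlib

open Filter

/-! ### Gromov-hyperbolic spaces, their boundaries, and actions on them -/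

/-- The Gromov product `(x | y)_o`. -/
noncomputable def gromovProduct {M : Type*} [MetricSpace M] (o x y : M) : ℝ :=
  (dist x o + dist y o - dist x y) / 2

/-- Gromov hyperbolicity: `(x | z)_o ≥ min ((x | y)_o, (y | z)_o) - δ` for some `δ` and all
points. -/
class GromovHyperbolic (M : Type*) [MetricSpace M] : Prop where
  exists_delta : ∃ δ : ℝ, ∀ o x y z : M,
    min (gromovProduct o x y) (gromovProduct o y z) - δ ≤ gromovProduct o x z

/-- `(x i | y j)_o → ∞` as `i, j → ∞`, for every base point `o`. -/
def GromovConverge {M : Type*} [MetricSpace M] (x y : ℕ → M) : Prop :=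
  ∀ o : M, Tendsto (fun p : ℕ × ℕ => gromovProduct o (x p.1) (y p.2)) (atTop ×ˢ atTop) atTop

theorem GromovConverge.symm {M : Type*} [MetricSpace M] {x y : ℕ → M}
    (h : GromovConverge x y) : GromovConverge y x := by
  intro o
  refine ((h o).comp tendsto_prod_swap).congr fun p => ?_
  simp only [Function.comp, gromovProduct, Prod.fst_swap, Prod.snd_swap, dist_comm (x p.2) (y p.1)]
  ring

theorem GromovConverge.trans {M : Type*} [MetricSpace M] [GromovHyperbolic M] {x y z : ℕ → M}
    (h : GromovConverge x y) (h' : GromovConverge y z) : GromovConverge x z := by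
  obtain ⟨δ, hδ⟩ := GromovHyperbolic.exists_delta (M := M)
  intro o
  have h1 := h o
  have h2 := h' o
  rw [prod_atTop_atTop_eq, tendsto_atTop_atTop] at h1 h2 ⊢
  intro b
  obtain ⟨p, hp⟩ := h1 (b + δ)
  obtain ⟨q, hq⟩ := h2 (b + δ)
  refine ⟨(p.1, q.2), fun r hr => ?_⟩
  have e1 := hp (r.1, max p.2 q.1) ⟨hr.1, le_max_left _ _⟩
  have e2 := hq (max p.2 q.1, r.2) ⟨le_max_right _ _, hr.2⟩
  have e3 := hδ o (x r.1) (y (max p.2 q.1)) (z r.2)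
  have e4 := le_min e1 e2
  simp only at e4
  linarith

/-- Sequences converging to infinity. -/
def GromovSeq (M : Type*) [MetricSpace M] : Type _ :=
  {x : ℕ → M // GromovConverge x x}

/-- Two sequences converging to infinity are equivalent when `(x i | y j)_o → ∞`. -/
instance gromovSetoid (M : Type*) [MetricSpace M] [GromovHyperbolic M] : Setoid (GromovSeq M) where
  r x y := GromovConverge x.1 y.1
  iseqv := ⟨fun x => x.2, fun h => h.symm, fun h h' => h.trans h'⟩

/-- The boundary at infinity of a hyperbolic space. -/
def GromovBoundary (M : Type*) [MetricSpace M] [GromovHyperbolic M] : Type _ :=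
  Quotient (gromovSetoid M)

/-- `g` is loxodromic: some orbit map `n ↦ g ^ n • o` is a quasi-isometric embedding `ℤ → M`. -/
def IsLoxodromic {G : Type*} [Group G] (M : Type*) [MetricSpace M] [MulAction G M] (g : G) : Prop :=
  ∃ o : M, ∃ K C : ℝ, 0 < K ∧ ∀ m n : ℤ,
    |(m : ℝ) - n| / K - C ≤ dist (g ^ m • o) (g ^ n • o) ∧
      dist (g ^ m • o) (g ^ n • o) ≤ K * |(m : ℝ) - n| + C

/-- The endpoints at infinity of `g`: the limits of `g ^ n • o` as `n → +∞` and as `n → -∞`. -/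
def endpoints {G : Type*} [Group G] (M : Type*) [MetricSpace M] [GromovHyperbolic M]
    [MulAction G M] (g : G) : Set (GromovBoundary M) :=
  {ξ | ∃ (o : M) (s : GromovSeq M), Quotient.mk (gromovSetoid M) s = ξ ∧
    ((∀ n : ℕ, s.1 n = g ^ n • o) ∨ (∀ n : ℕ, s.1 n = g⁻¹ ^ n • o))}

/-- The possible types of actions on hyperbolic spaces. -/
inductive ActionLabel : Type
  | bounded
  | horocyclic
  | lineal
  | focal
  | generalType

/-- The loxodromic elements exist and all have the same endpoints at infinity. -/
def IsLinealAction (G : Type*) [Group G] (M : Type*) [MetricSpace M] [GromovHyperbolic M]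
    [MulAction G M] : Prop :=
  (∃ g : G, IsLoxodromic M g) ∧
    ∀ g h : G, IsLoxodromic M g → IsLoxodromic M h → endpoints M g = endpoints M h

/-- The isometric action of `G` on the hyperbolic space `M` has the given type. -/
def ActionHasLabel (G : Type*) [Group G] (M : Type*) [MetricSpace M] [GromovHyperbolic M]
    [MulAction G M] [IsIsometricSMul G M] : ActionLabel → Prop
  | .bounded => ∀ o : M, Bornology.IsBounded (MulAction.orbit G o)
  | .horocyclic => (¬ ∀ o : M, Bornology.IsBounded (MulAction.orbit G o)) ∧
      ¬ ∃ g : G, IsLoxodromic M g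
  | .lineal => IsLinealAction G M
  | .focal => (∃ g : G, IsLoxodromic M g) ∧ ¬ IsLinealAction G M ∧
      ∀ g h : G, IsLoxodromic M g → IsLoxodromic M h → (endpoints M g ∩ endpoints M h).Nonempty
  | .generalType => ∃ g h : G, IsLoxodromic M g ∧ IsLoxodromic M h ∧
      Disjoint (endpoints M g) (endpoints M h)

/-! ### Generating sets and Cayley graphs -/

/-- A (not necessarily finite) generating set of `G`. -/
structure GenSet (G : Type*) [Group G] where
  carrier : Set G
  generates : Subgroup.closure carrier = ⊤

theorem GenSet.connected {G : Type*} [Group G] (X : GenSet G) :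
    (SimpleGraph.mulCayley X.carrier).Connected := by
  have key : ∀ g : G, ∀ a : G, (SimpleGraph.mulCayley X.carrier).Reachable a (a * g) := by
    intro g
    have hg : g ∈ Subgroup.closure X.carrier := by rw [X.generates]; trivial
    induction hg using Subgroup.closure_induction with
    | mem x hx =>
      intro a
      by_cases h : a = a * x
      · rw [← h]
      · exact SimpleGraph.Adj.reachable (by
          rw [SimpleGraph.mulCayley_adj]
          exact ⟨h, Or.inl (by simpa using hx)⟩)
    | one => intro a; rw [mul_one]
    | mul x y _ _ hx hy =>
      intro a
      rw [← mul_assoc]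
      exact (hx a).trans (hy (a * x))
    | inv x _ hx =>
      intro a
      simpa using (hx (a * x⁻¹)).symm
  refine ⟨fun a b => ?_⟩
  simpa using key (a⁻¹ * b) a

/-- The vertex set of the Cayley graph `Cayl(G, X)`. -/
def Cayl {G : Type*} [Group G] (_X : GenSet G) : Type _ := G

/-- `Cayl(G, X)` carries the graph metric. -/
noncomputable instance {G : Type*} [Group G] (X : GenSet G) : MetricSpace (Cayl X) where
  dist (a b : G) := ((SimpleGraph.mulCayley X.carrier).dist a b : ℝ)
  dist_self (a : G) := by simp
  dist_comm (a b : G) := by rw [SimpleGraph.dist_comm]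
  dist_triangle (a b c : G) := by
    exact_mod_cast X.connected.dist_triangle
  eq_of_dist_eq_zero {a b : G} h := by
    exact X.connected.dist_eq_zero_iff.mp (by exact_mod_cast h)

theorem Cayl.dist_def {G : Type*} [Group G] (X : GenSet G) (a b : Cayl X) :
    dist a b = ((SimpleGraph.mulCayley X.carrier).dist (a : G) (b : G) : ℝ) := rfl

/-- A graph isomorphism preserves distances. -/
theorem SimpleGraph.Iso.dist_eq_dist {V W : Type*} {A : SimpleGraph V} {B : SimpleGraph W}
    (f : A ≃g B) (hA : A.Connected) (u v : V) : B.dist (f u) (f v) = A.dist u v := by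
  have hB : B.Connected := f.connected_iff.mp hA
  apply le_antisymm
  · obtain ⟨p, hp⟩ := hA.exists_walk_length_eq_dist u v
    rw [← hp, ← SimpleGraph.Walk.length_map f.toHom p]
    exact SimpleGraph.dist_le _
  · obtain ⟨p, hp⟩ := hB.exists_walk_length_eq_dist (f u) (f v)
    rw [← hp, ← SimpleGraph.Walk.length_map f.symm.toHom p]
    have := SimpleGraph.dist_le (p.map f.symm.toHom)
    simpa using this

/-- `G` acts on `Cayl(G, X)` by left multiplication. -/
instance {G : Type*} [Group G] (X : GenSet G) : MulAction G (Cayl X) :=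
  inferInstanceAs (MulAction G G)

instance {G : Type*} [Group G] (X : GenSet G) : IsIsometricSMul G (Cayl X) where
  isometry_smul g := Isometry.of_dist_eq fun a b => by
    have h := SimpleGraph.Iso.dist_eq_dist (A := SimpleGraph.mulCayley X.carrier)
      (B := SimpleGraph.mulCayley X.carrier)
      ⟨Equiv.mulLeft g, by intro a b; exact SimpleGraph.mulCayley_adj_mul_iff_right⟩
      X.connected a b
    exact congrArg (Nat.cast : ℕ → ℝ) h

/-- Word length with respect to `X`, that is the distance to `1` in `Cayl(G, X)`. -/
noncomputable def GenSet.wordLength {G : Type*} [Group G] (X : GenSet G) (g : G) : ℕ :=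
  (SimpleGraph.mulCayley X.carrier).dist 1 g

theorem GenSet.dist_mul {G : Type*} [Group G] (X : GenSet G) (a g : G) :
    (SimpleGraph.mulCayley X.carrier).dist a (a * g) = X.wordLength g := by
  have h := SimpleGraph.Iso.dist_eq_dist (A := SimpleGraph.mulCayley X.carrier)
      (B := SimpleGraph.mulCayley X.carrier)
      ⟨Equiv.mulLeft a, by intro a b; exact SimpleGraph.mulCayley_adj_mul_iff_right⟩
      X.connected 1 g
  have e : (SimpleGraph.mulCayley X.carrier).dist (a * 1) (a * g) = X.wordLength g := h
  rwa [mul_one] at e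

theorem GenSet.wordLength_le_of_mem {G : Type*} [Group G] (X : GenSet G) {g : G}
    (hg : g ∈ X.carrier) : X.wordLength g ≤ 1 := by
  by_cases h : 1 = g
  · subst h; simp [GenSet.wordLength]
  · have : (SimpleGraph.mulCayley X.carrier).Adj 1 g := by
      rw [SimpleGraph.mulCayley_adj]
      exact ⟨h, Or.inl (by simpa using hg)⟩
    exact (SimpleGraph.dist_eq_one_iff_adj.mpr this).le

/-- If every element of `Y` has `X`-length at most `C`, then `d_X ≤ C * d_Y`. -/
theorem GenSet.wordLength_le_mul {G : Type*} [Group G] (X Y : GenSet G) (C : ℕ)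
    (h : ∀ y ∈ Y.carrier, X.wordLength y ≤ C) (g : G) :
    X.wordLength g ≤ C * Y.wordLength g := by
  have key : ∀ (a b : G) (p : (SimpleGraph.mulCayley Y.carrier).Walk a b),
      (SimpleGraph.mulCayley X.carrier).dist a b ≤ C * p.length := by
    intro a b p
    induction p with
    | nil => simp
    | @cons a b c hab p ih =>
      have h1 : (SimpleGraph.mulCayley X.carrier).dist a b ≤ C := by
        rw [SimpleGraph.mulCayley_adj] at hab
        rcases hab.2 with h2 | h2
        · have := X.dist_mul a (a⁻¹ * b)
          rw [mul_inv_cancel_left] at this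
          rw [this]; exact h _ h2
        · have := X.dist_mul b (b⁻¹ * a)
          rw [mul_inv_cancel_left] at this
          rw [SimpleGraph.dist_comm, this]; exact h _ h2
      have h3 := X.connected.dist_triangle (u := a) (v := b) (w := c)
      rw [SimpleGraph.Walk.length_cons, mul_add, mul_one]
      omega
  obtain ⟨p, hp⟩ := Y.connected.exists_walk_length_eq_dist 1 g
  have := key _ _ p
  rwa [hp] at this

/-- `X ≤ Y` when the `X`-lengths of the elements of `Y` are bounded. -/
instance {G : Type*} [Group G] : Preorder (GenSet G) where
  le X Y := ∃ C : ℕ, ∀ y ∈ Y.carrier, X.wordLength y ≤ C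
  le_refl X := ⟨1, fun _ hy => X.wordLength_le_of_mem hy⟩
  le_trans X Y Z := by
    rintro ⟨C, hC⟩ ⟨D, hD⟩
    exact ⟨C * D, fun z hz => (X.wordLength_le_mul Y C hC z).trans
      (Nat.mul_le_mul_left C (hD z hz))⟩

/-! ### Hyperbolic structures -/

/-- Generating sets with hyperbolic Cayley graph, with the preorder of generating sets. -/
abbrev HypGenSet (G : Type*) [Group G] : Type _ := {X : GenSet G // GromovHyperbolic (Cayl X)}

instance {G : Type*} [Group G] (X : HypGenSet G) : GromovHyperbolic (Cayl X.1) := X.2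

/-- The poset of hyperbolic structures of `G`: hyperbolic generating sets modulo the relation
`X ≤ Y ∧ Y ≤ X`. -/
abbrev HypStructure (G : Type*) [Group G] : Type _ := Antisymmetrization (HypGenSet G) (· ≤ ·)

/-- The hyperbolic structure `[X]`. -/
abbrev HypGenSet.toStructure {G : Type*} [Group G] (X : HypGenSet G) : HypStructure G :=
  toAntisymmetrization (· ≤ ·) X

/-- The action of `G` on `Cayl(G, X)` has the given label. -/
def HypGenSet.HasLabel {G : Type*} [Group G] (X : HypGenSet G) (l : ActionLabel) : Prop :=
  ActionHasLabel G (Cayl X.1) l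

/-- The image of a generating set under an automorphism. -/
def GenSet.map {G : Type*} [Group G] (φ : MulAut G) (X : GenSet G) : GenSet G where
  carrier := φ '' X.carrier
  generates := by
    have h := MonoidHom.map_closure (φ : G ≃* G).toMonoidHom X.carrier
    rw [X.generates, Subgroup.map_top_of_surjective _ (MulEquiv.surjective φ)] at h
    exact h.symm

theorem GenSet.dist_map {G : Type*} [Group G] (φ : MulAut G) (X : GenSet G) (a b : G) :
    (SimpleGraph.mulCayley (X.map φ).carrier).dist (φ a) (φ b) =
      (SimpleGraph.mulCayley X.carrier).dist a b :=
  SimpleGraph.Iso.dist_eq_dist (A := SimpleGraph.mulCayley X.carrier)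
    (B := SimpleGraph.mulCayley (X.map φ).carrier)
    ⟨(φ : G ≃* G).toEquiv, by
      intro a b
      simp [SimpleGraph.mulCayley_adj, GenSet.map, ← map_inv, ← map_mul]⟩
    X.connected a b

theorem GenSet.wordLength_map {G : Type*} [Group G] (φ : MulAut G) (X : GenSet G) (g : G) :
    (X.map φ).wordLength (φ g) = X.wordLength g := by
  have h := X.dist_map φ 1 g
  rwa [map_one] at h

theorem GromovHyperbolic.of_isometry {M N : Type*} [MetricSpace M] [MetricSpace N]
    [hM : GromovHyperbolic M] (f : M → N) (hf : Isometry f) (hs : Function.Surjective f) :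
    GromovHyperbolic N := by
  obtain ⟨δ, hδ⟩ := hM.exists_delta
  refine ⟨δ, fun o x y z => ?_⟩
  obtain ⟨o, rfl⟩ := hs o
  obtain ⟨x, rfl⟩ := hs x
  obtain ⟨y, rfl⟩ := hs y
  obtain ⟨z, rfl⟩ := hs z
  simpa only [gromovProduct, hf.dist_eq] using hδ o x y z

theorem GenSet.gromovHyperbolic_map {G : Type*} [Group G] (φ : MulAut G) (X : GenSet G)
    [GromovHyperbolic (Cayl X)] : GromovHyperbolic (Cayl (X.map φ)) :=
  GromovHyperbolic.of_isometry (M := Cayl X) (N := Cayl (X.map φ)) (fun g : G => (φ g : G))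
    (Isometry.of_dist_eq fun a b => congrArg (Nat.cast : ℕ → ℝ) (X.dist_map φ a b))
    (fun g => ⟨φ.symm g, MulEquiv.apply_symm_apply φ g⟩)

/-- `X ↦ φ(X)`. -/
def HypGenSet.map {G : Type*} [Group G] (φ : MulAut G) : HypGenSet G →o HypGenSet G where
  toFun X := ⟨X.1.map φ, have := X.2; X.1.gromovHyperbolic_map φ⟩
  monotone' := by
    rintro X Y ⟨C, hC⟩
    refine ⟨C, ?_⟩
    rintro _ ⟨y, hy, rfl⟩
    exact (X.1.wordLength_map φ y).trans_le (hC y hy)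

/-- The hyperbolic structure `φ ∗ [X] = [φ(X)]`. -/
def HypStructure.map {G : Type*} [Group G] (φ : MulAut G) : HypStructure G →o HypStructure G :=
  (HypGenSet.map φ).antisymmetrization

/-- The `F`-invariant hyperbolic structures, ordered as hyperbolic structures. -/
abbrev InvHypStructure {G : Type*} [Group G] (F : Subgroup (MulAut G)) : Type _ :=
  {x : HypStructure G // ∀ φ ∈ F, HypStructure.map φ x = x}

/-- The semidirect product `G ⋊ F` for the tautological action of `F ≤ Aut(G)` on `G`. -/
abbrev AutSemidirect {G : Type*} [Group G] (F : Subgroup (MulAut G)) : Type _ :=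
  G ⋊[F.subtype] F

/-- The generating set `X ∪ F` of `G ⋊ F`. -/
def GenSet.union {G : Type*} [Group G] (X : GenSet G) (F : Subgroup (MulAut G)) :
    GenSet (AutSemidirect F) where
  carrier := (SemidirectProduct.inl '' X.carrier) ∪ Set.range SemidirectProduct.inr
  generates := by
    rw [eq_top_iff]
    intro g _
    rw [← SemidirectProduct.inl_left_mul_inr_right g]
    refine mul_mem ?_ (Subgroup.subset_closure (Or.inr ⟨_, rfl⟩))
    refine Subgroup.closure_mono (Set.subset_union_left) ?_
    rw [← MonoidHom.map_closure, X.generates]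
    exact ⟨_, trivial, rfl⟩

/-!
Write `H = G ⋊ F`. If `[X]` is `F`-invariant then, `F` being finite, the automorphisms in `F` distort
`X`-lengths by a bounded factor. Moving the letters from `F` in a word in `X ∪ F` to the right then
shows that the projection `H → G` is Lipschitz from `Cayl(H, X ∪ F)` to `Cayl(G, X)`
(`GenSet.IsCoarselyInvariant.exists_dist_left_le`). So this projection, and the inclusion `G → H`,
are quasi-isometric embeddings between these graphs. This makes `X ∪ F` hyperbolic and shows that
`X ∪ F ≤ Y ∪ F` implies `X ≤ Y`. Conversely, a hyperbolic generating set `Z` of `H` is equivalent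
to `X ∪ F` for the generating set `X = G ∩ F Z F` of `G`, which is literally `F`-invariant
(`GenSet.restrict`). Hence `[X] ↦ [X ∪ F]` is a surjective order embedding.

The geometric input is that quasi-isometric embeddings `f : M → N` of graphs into hyperbolic graphs
pull back hyperbolicity (`IsQIEmbedding.gromovHyperbolic`) and coarsely preserve Gromov products
(`IsQIEmbedding.exists_gromovProduct_le`); by the second statement `f` induces an injection of
boundaries at infinity. Both rest on the stability of quasi-geodesics: a geodesic stays close to a
quasi-geodesic with the same ends, because a path avoiding a large ball around a point of the
geodesic has length exponential in the radius (`le_gromovProduct_of_chain`,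
`exists_dist_quasiGeodesic_le`), and the reverse closeness follows by connectedness.

Labels are compared along the `G`-equivariant inclusion `Cayl(G, X) → Cayl(H, Y)`, for any
`Y` equivalent to `X ∪ F`. An element of `G` is loxodromic for one action if and only if it is for
the other, its endpoints correspond under the boundary map, and since `G` has finite index in `H`,
every loxodromic element of `H` has a power in `G`, which has the same endpoints
(`IsQIEmbedding.actionHasLabel_iff`).
-/

/-! ### Gromov products and hyperbolicity constants -/

theorem gromovProduct_comm {M : Type*} [MetricSpace M] (o x y : M) :
    gromovProduct o x y = gromovProduct o y x := by
  simp only [gromovProduct, dist_comm x y]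
  ring

theorem gromovProduct_self {M : Type*} [MetricSpace M] (o x : M) :
    gromovProduct o x x = dist x o := by
  simp [gromovProduct]

theorem gromovProduct_base_le {M : Type*} [MetricSpace M] (o o' x y : M) :
    gromovProduct o x y ≤ gromovProduct o' x y + dist o o' := by
  have h1 := dist_triangle x o' o
  have h2 := dist_triangle y o' o
  rw [dist_comm o' o] at h1 h2
  simp only [gromovProduct]
  linarith

theorem gromovProduct_left_le {M : Type*} [MetricSpace M] (o x x' y : M) :
    gromovProduct o x y ≤ gromovProduct o x' y + dist x x' := by
  have h1 := dist_triangle x x' o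
  have h2 := dist_triangle x' x y
  rw [dist_comm x' x] at h2
  simp only [gromovProduct]
  linarith

theorem GromovHyperbolic.exists_nonneg (M : Type*) [MetricSpace M] [GromovHyperbolic M] :
    ∃ δ : ℝ, 0 ≤ δ ∧ ∀ o x y z : M,
      min (gromovProduct o x y) (gromovProduct o y z) - δ ≤ gromovProduct o x z := by
  obtain ⟨δ, hδ⟩ := GromovHyperbolic.exists_delta (M := M)
  refine ⟨max δ 0, le_max_right _ _, fun o x y z => ?_⟩
  have := hδ o x y z
  have := le_max_left δ 0
  linarith

/-! ### Discrete geodesics and quasi-geodesics -/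

/-- The points `p 0, …, p n` form a discrete quasi-geodesic with constant `C`. The values of `p`
beyond `n` are irrelevant. The upper bound carries no additive constant, since all quasi-geodesics
below are images of geodesics under Lipschitz maps. -/
structure IsQuasiGeodesic {M : Type*} [MetricSpace M] (C : ℝ) (p : ℕ → M) (n : ℕ) : Prop where
  dist_le : ∀ i j, i ≤ n → j ≤ n → dist (p i) (p j) ≤ C * |(i : ℝ) - j|
  le_dist : ∀ i j, i ≤ n → j ≤ n → |(i : ℝ) - j| ≤ C * dist (p i) (p j) + C

/-- The points `γ 0 = x, …, γ n = y` form a geodesic from `x` to `y`, parametrized by the integers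
`0, …, n`. -/
structure IsGeodesicFromTo {M : Type*} [MetricSpace M] (γ : ℕ → M) (n : ℕ) (x y : M) : Prop where
  zero : γ 0 = x
  last : γ n = y
  dist_eq : ∀ i j, i ≤ n → j ≤ n → dist (γ i) (γ j) = |(i : ℝ) - j|

/-- Any two points are joined by a geodesic parametrized by integers, as in the vertex set of a
connected graph. -/
def IsGraphLike (M : Type*) [MetricSpace M] : Prop :=
  ∀ x y : M, ∃ (n : ℕ) (γ : ℕ → M), IsGeodesicFromTo γ n x y

theorem IsGeodesicFromTo.dist_left {M : Type*} [MetricSpace M] {γ : ℕ → M} {n : ℕ} {x y : M}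
    (h : IsGeodesicFromTo γ n x y) {i : ℕ} (hi : i ≤ n) : dist x (γ i) = i := by
  rw [← h.zero, h.dist_eq 0 i (Nat.zero_le _) hi]
  simp

theorem IsGeodesicFromTo.dist_right {M : Type*} [MetricSpace M] {γ : ℕ → M} {n : ℕ} {x y : M}
    (h : IsGeodesicFromTo γ n x y) {i : ℕ} (hi : i ≤ n) : dist (γ i) y = n - i := by
  have hi' : (i : ℝ) ≤ n := by exact_mod_cast hi
  rw [← h.last, h.dist_eq i n hi le_rfl, abs_sub_comm, abs_of_nonneg (by linarith)]

theorem IsGeodesicFromTo.dist_ends {M : Type*} [MetricSpace M] {γ : ℕ → M} {n : ℕ} {x y : M}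
    (h : IsGeodesicFromTo γ n x y) : dist x y = n := by
  rw [← h.last, h.dist_left le_rfl]

/-- A point on a geodesic is at least as far from the base point as the Gromov product of the
ends. -/
theorem IsGeodesicFromTo.gromovProduct_le {M : Type*} [MetricSpace M] {γ : ℕ → M} {n : ℕ}
    {x y : M} (h : IsGeodesicFromTo γ n x y) {i : ℕ} (hi : i ≤ n) (o : M) :
    gromovProduct o x y ≤ dist o (γ i) := by
  have h1 := h.dist_left hi
  have h2 := h.dist_right hi
  have h3 := h.dist_ends
  have h4 := dist_triangle x (γ i) o
  have h5 := dist_triangle_left y o (γ i)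
  rw [dist_comm (γ i) o] at h4 h5
  simp only [gromovProduct]
  linarith

/-! ### Stability of quasi-geodesics -/

/-- Geodesics diverge exponentially: a chain of at most `2 ^ k` short steps that stays far from `o`
has ends with a large Gromov product, up to an error linear in `k`. Each dyadic subdivision costs
one application of the hyperbolicity inequality. -/
theorem le_gromovProduct_of_chain {M : Type*} [MetricSpace M] {δ : ℝ}
    (hδ : ∀ o x y z : M,
      min (gromovProduct o x y) (gromovProduct o y z) - δ ≤ gromovProduct o x z)
    {o : M} {B L : ℝ} (hL : 0 ≤ L) (k : ℕ) :
    ∀ (n : ℕ) (p : ℕ → M), n ≤ 2 ^ k → (∀ i ≤ n, B ≤ dist (p i) o) →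
      (∀ i < n, dist (p i) (p (i + 1)) ≤ L) → B - L - k * δ ≤ gromovProduct o (p 0) (p n) := by
  induction k with
  | zero =>
    intro n p hn hB hs
    have h0 := hB 0 (Nat.zero_le _)
    rcases Nat.le_one_iff_eq_zero_or_eq_one.mp (by simpa using hn) with rfl | rfl
    · rw [gromovProduct_self]
      simp only [Nat.cast_zero]
      linarith
    · have h1 := hB 1 le_rfl
      have h2 := hs 0 Nat.zero_lt_one
      simp only [gromovProduct, Nat.cast_zero]
      simp only [zero_add] at h2
      linarith
  | succ k ih =>
    intro n p hn hB hs
    have hpow : 2 ^ (k + 1) = 2 * 2 ^ k := by ring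
    have h1 := ih (n / 2) p (by omega) (fun i hi => hB i (by omega)) (fun i hi => hs i (by omega))
    have h2 := ih (n - n / 2) (fun i => p (n / 2 + i)) (by omega) (fun i hi => hB _ (by omega))
      (fun i hi => hs (n / 2 + i) (by omega))
    simp only [add_zero] at h2
    rw [show n / 2 + (n - n / 2) = n by omega] at h2
    have h3 := hδ o (p 0) (p (n / 2)) (p n)
    have h4 := le_min h1 h2
    push_cast
    linarith

/-- A real number bounded by a multiple of its own logarithm is bounded. The hypothesis avoids the
logarithm by quantifying over the exponents of the powers of two above `c * D + c`. -/
theorem exists_bound_of_le_log (A c δ : ℝ) (hc : 1 ≤ c) (hδ : 0 ≤ δ) :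
    ∃ H : ℝ, ∀ D : ℝ, 0 ≤ D → (∀ k : ℕ, c * D + c ≤ 2 ^ k → D ≤ A + k * δ) → D ≤ H := by
  have hlim : Tendsto (fun n : ℕ => (c * (A + (n + 1) * δ) + c) / 2 ^ n) atTop (nhds 0) := by
    have h1 := tendsto_pow_const_div_const_pow_of_one_lt 1 (r := (2 : ℝ)) one_lt_two
    have h0 := tendsto_pow_const_div_const_pow_of_one_lt 0 (r := (2 : ℝ)) one_lt_two
    have := (h1.const_mul (c * δ)).add (h0.const_mul (c * (A + δ) + c))
    simp only [mul_zero, add_zero] at this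
    refine this.congr fun n => ?_
    field_simp
    ring
  obtain ⟨n₀, hn₀⟩ := eventually_atTop.mp (hlim.eventually (gt_mem_nhds zero_lt_one))
  refine ⟨A + (n₀ + 1) * δ, fun D hD h => ?_⟩
  obtain ⟨n, hn1, hn2⟩ := exists_nat_pow_near (x := c * D + c) (y := 2)
    (by nlinarith) one_lt_two
  have h1 := h (n + 1) hn2.le
  push_cast at h1
  have hn : n < n₀ := by
    by_contra hcon
    have h2 := hn₀ n (not_lt.mp hcon)
    rw [div_lt_one (by positivity)] at h2
    have : c * D ≤ c * (A + (n + 1) * δ) := by gcongr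
    linarith
  have hn' : (n : ℝ) ≤ n₀ := by exact_mod_cast hn.le
  nlinarith

/-- First half of the stability of quasi-geodesics: a geodesic stays close to every quasi-geodesic
with the same ends. -/
theorem exists_dist_quasiGeodesic_le (M : Type*) [MetricSpace M] [GromovHyperbolic M]
    {C : ℝ} (hC : 1 ≤ C) :
    ∃ H : ℝ, 0 ≤ H ∧ ∀ (n : ℕ) (p : ℕ → M), IsQuasiGeodesic C p n → ∀ (m : ℕ) (γ : ℕ → M),
      IsGeodesicFromTo γ m (p 0) (p n) → ∀ j ≤ m, ∃ i ≤ n, dist (γ j) (p i) ≤ H := by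
  obtain ⟨δ, hδ0, hδ⟩ := GromovHyperbolic.exists_nonneg M
  obtain ⟨H, hH⟩ := exists_bound_of_le_log (C + 2 * δ) (6 * C) δ (by linarith) hδ0
  refine ⟨max H 0, le_max_right _ _, fun n p hp m γ hγ => ?_⟩
  have hne : (Finset.range (n + 1)).Nonempty := ⟨0, by simp⟩
  -- `e j` is the distance from `γ j` to the quasi-geodesic.
  set e : ℕ → ℝ := fun j => (Finset.range (n + 1)).inf' hne (fun i => dist (γ j) (p i)) with he
  have hel : ∀ j i, i ≤ n → e j ≤ dist (γ j) (p i) := fun j i hi =>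
    Finset.inf'_le _ (Finset.mem_range.mpr (by omega))
  have hex : ∀ j, ∃ i ≤ n, dist (γ j) (p i) = e j := fun j => by
    obtain ⟨i, hi, h⟩ := Finset.exists_mem_eq_inf' hne (fun i => dist (γ j) (p i))
    exact ⟨i, by simpa [Nat.lt_succ_iff] using hi, h.symm⟩
  obtain ⟨j₀, hj₀, hmax⟩ := Finset.exists_max_image (Finset.range (m + 1)) e ⟨0, by simp⟩
  have hj₀ : j₀ ≤ m := by simpa [Nat.lt_succ_iff] using hj₀
  have hmax : ∀ j ≤ m, e j ≤ e j₀ := fun j hj => hmax j (by simpa [Nat.lt_succ_iff] using hj)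
  set D := e j₀ with hD
  have hD0 : 0 ≤ D := by
    obtain ⟨i, -, h⟩ := hex j₀
    rw [hD, ← h]
    exact dist_nonneg
  suffices hDH : D ≤ H by
    intro j hj
    obtain ⟨i, hi, h⟩ := hex j
    exact ⟨i, hi, (h.trans_le ((hmax j hj).trans hDH)).trans (le_max_left _ _)⟩
  refine hH D hD0 fun k hk => ?_
  -- Walk from `γ j₀` a distance about `2 * D` along the geodesic in both directions, stopping at
  -- the ends, and then jump to the quasi-geodesic.
  set t := ⌈2 * D⌉₊ with ht
  have ht1 : 2 * D ≤ t := Nat.le_ceil _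
  have ht2 : (t : ℝ) < 2 * D + 1 := Nat.ceil_lt_add_one (by linarith)
  have side : ∀ j ≤ m, |(j : ℝ) - j₀| ≤ t →
      (2 * D ≤ |(j : ℝ) - j₀| ∨ ∃ a ≤ n, γ j = p a) →
      ∃ a ≤ n, D ≤ gromovProduct (γ j₀) (γ j) (p a) ∧ dist (γ j₀) (p a) ≤ 3 * D + 1 := by
    intro j hj hjt hcase
    have hd := hγ.dist_eq j j₀ hj hj₀
    rcases hcase with h | ⟨a, ha, h⟩
    · obtain ⟨a, ha, h'⟩ := hex j
      have h1 := hel j₀ a ha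
      have h2 := hmax j hj
      have h3 := dist_triangle_left (γ j₀) (p a) (γ j)
      refine ⟨a, ha, ?_, by linarith⟩
      rw [dist_comm (γ j₀)] at h1
      simp only [gromovProduct]
      linarith
    · have h1 := hel j₀ a ha
      refine ⟨a, ha, ?_, ?_⟩
      · rw [h, gromovProduct_self, dist_comm]
        exact h1
      · rw [← h, dist_comm]
        linarith
  obtain ⟨a, ha, ha1, ha2⟩ := side (j₀ - t) (by omega)
    (by
      rcases le_total t j₀ with h | h
      · rw [Nat.cast_sub h]; simp
      · rw [Nat.sub_eq_zero_of_le h]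
        simpa using h)
    (by
      rcases le_total t j₀ with h | h
      · rw [Nat.cast_sub h]; simpa using Or.inl ht1
      · exact Or.inr ⟨0, Nat.zero_le _, by rw [Nat.sub_eq_zero_of_le h, hγ.zero]⟩)
  obtain ⟨b, hb, hb1, hb2⟩ := side (min (j₀ + t) m) (by omega)
    (by
      rcases le_total (j₀ + t) m with h | h
      · rw [min_eq_left h]; simp
      · rw [min_eq_right h]
        have h1 : (m : ℝ) ≤ j₀ + t := by exact_mod_cast h
        have h2 : (j₀ : ℝ) ≤ m := by exact_mod_cast hj₀
        rw [abs_of_nonneg (by linarith)]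
        linarith)
    (by
      rcases le_total (j₀ + t) m with h | h
      · rw [min_eq_left h]; simpa using Or.inl ht1
      · exact Or.inr ⟨n, le_rfl, by rw [min_eq_right h, hγ.last]⟩)
  -- The piece of the quasi-geodesic between the two landing points is a chain of at most `2 ^ k`
  -- steps that stays `D`-far from `γ j₀`.
  have hab : |(a : ℝ) - b| ≤ 2 ^ k := by
    have h1 := hp.le_dist a b ha hb
    have h2 := dist_triangle_left (p a) (p b) (γ j₀)
    have h3 : C * dist (p a) (p b) ≤ C * (6 * D + 2) := by gcongr; linarith
    nlinarith
  have chain : ∀ a b : ℕ, a ≤ b → b ≤ n → |(a : ℝ) - b| ≤ 2 ^ k →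
      D - C - k * δ ≤ gromovProduct (γ j₀) (p a) (p b) := by
    intro a b hab hb h
    have h' : b - a ≤ 2 ^ k := by
      rw [abs_sub_comm, ← Nat.cast_sub hab, Nat.abs_cast] at h
      exact_mod_cast h
    have := le_gromovProduct_of_chain hδ (o := γ j₀) (B := D) (L := C) (by linarith) k (b - a)
      (fun i => p (a + i)) h'
      (fun i hi => by rw [dist_comm]; exact hel j₀ _ (by omega))
      (fun i hi => by
        have := hp.dist_le (a + i) (a + (i + 1)) (by omega) (by omega)
        push_cast at this
        simpa [show (a : ℝ) + i - (a + (i + 1)) = -1 by ring] using this)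
    simpa [Nat.add_sub_cancel' hab] using this
  have hmid : D - C - k * δ ≤ gromovProduct (γ j₀) (p a) (p b) := by
    rcases le_total a b with h | h
    · exact chain a b h hb hab
    · rw [gromovProduct_comm]
      exact chain b a h ha (by rwa [abs_sub_comm])
  -- The Gromov product of two points of the geodesic vanishes at a point between them.
  have hzero : gromovProduct (γ j₀) (γ (j₀ - t)) (γ (min (j₀ + t) m)) = 0 := by
    have h1 : ((j₀ - t : ℕ) : ℝ) ≤ j₀ := by exact_mod_cast Nat.sub_le _ _
    have h2 : (j₀ : ℝ) ≤ (min (j₀ + t) m : ℕ) := by exact_mod_cast (by omega)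
    rw [gromovProduct, hγ.dist_eq _ _ (by omega) hj₀, hγ.dist_eq _ _ (by omega) hj₀,
      hγ.dist_eq _ _ (by omega) (by omega), abs_of_nonpos (by linarith),
      abs_of_nonneg (by linarith), abs_of_nonpos (by linarith)]
    ring
  have g1 := hδ (γ j₀) (γ (j₀ - t)) (p a) (γ (min (j₀ + t) m))
  have g2 := hδ (γ j₀) (p a) (p b) (γ (min (j₀ + t) m))
  rw [gromovProduct_comm _ (p b)] at g2
  rw [hzero] at g1
  have hkδ : 0 ≤ (k : ℝ) * δ := by positivity
  have g3 : D - C - k * δ ≤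
      min (gromovProduct (γ j₀) (p a) (p b)) (gromovProduct (γ j₀) (γ (min (j₀ + t) m)) (p b)) :=
    le_min hmid (by linarith)
  have g4 : D - C - k * δ - δ ≤
      min (gromovProduct (γ j₀) (γ (j₀ - t)) (p a))
        (gromovProduct (γ j₀) (p a) (γ (min (j₀ + t) m))) :=
    le_min (by linarith) (by linarith)
  linarith

/-- Second half of the stability of quasi-geodesics: the Gromov product of the ends of a
quasi-geodesic, based at one of its points, is bounded. -/
theorem exists_gromovProduct_quasiGeodesic_le {M : Type*} [MetricSpace M] [GromovHyperbolic M]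
    (hM : IsGraphLike M) {C : ℝ} (hC : 1 ≤ C) :
    ∃ H : ℝ, ∀ (n : ℕ) (p : ℕ → M), IsQuasiGeodesic C p n → ∀ i ≤ n,
      gromovProduct (p i) (p 0) (p n) ≤ H := by
  obtain ⟨H, hH0, hH⟩ := exists_dist_quasiGeodesic_le M hC
  refine ⟨H + C * (C * (2 * H + 1) + C), fun n p hp i hi => ?_⟩
  obtain ⟨m, γ, hγ⟩ := hM (p 0) (p n)
  -- It suffices to find `a ≤ i ≤ a'` with `p a`, `p a'` boundedly close and `p a` close to `γ`.
  have key : ∀ a a' j : ℕ, a ≤ i → i ≤ a' → a' ≤ n → j ≤ m → dist (γ j) (p a) ≤ H →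
      dist (p a) (p a') ≤ 2 * H + 1 →
      gromovProduct (p i) (p 0) (p n) ≤ H + C * (C * (2 * H + 1) + C) := by
    intro a a' j hai hia' ha' hj h1 h2
    refine (hγ.gromovProduct_le hj _).trans ?_
    have h3 := dist_triangle_right (p i) (γ j) (p a)
    have h4 := hp.dist_le i a hi (hai.trans hi)
    have h5 := hp.le_dist a' a ha' (hai.trans hi)
    rw [dist_comm (p a')] at h5
    have h6 : (a : ℝ) ≤ i := by exact_mod_cast hai
    have h7 : (i : ℝ) ≤ a' := by exact_mod_cast hia'
    rw [abs_of_nonneg (by linarith)] at h4 h5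
    have h8 : C * dist (p a) (p a') ≤ C * (2 * H + 1) := by gcongr
    have h9 : C * ((i : ℝ) - a) ≤ C * (C * (2 * H + 1) + C) := by gcongr; linarith
    linarith
  by_cases hlast : ∃ a ≤ i, dist (γ m) (p a) ≤ H
  · obtain ⟨a, hai, ha⟩ := hlast
    refine key a n m hai hi le_rfl le_rfl ha ?_
    rw [← hγ.last, dist_comm]
    linarith
  · -- The last parameter `j` for which `γ j` is close to some `p a` with `a ≤ i`.
    have hstep : ∃ j < m, (∃ a ≤ i, dist (γ j) (p a) ≤ H) ∧
        ¬ ∃ a ≤ i, dist (γ (j + 1)) (p a) ≤ H := by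
      by_contra hcon
      push Not at hcon hlast
      have : ∀ j ≤ m, ∃ a ≤ i, dist (γ j) (p a) ≤ H := by
        intro j
        induction j with
        | zero => exact fun _ => ⟨0, Nat.zero_le _, by rw [hγ.zero, dist_self]; exact hH0⟩
        | succ j ih =>
          intro hj
          obtain ⟨a, ha, h⟩ := ih (by omega)
          exact hcon j (by omega) ⟨a, ha, h⟩
      obtain ⟨a, ha, h⟩ := this m le_rfl
      exact (hlast a ha).not_ge h
    obtain ⟨j, hj, ⟨a, hai, ha⟩, hn⟩ := hstep
    obtain ⟨a', ha'n, ha'⟩ := hH n p hp m γ hγ (j + 1) (by omega)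
    have hia' : i ≤ a' := by
      by_contra hcon
      exact hn ⟨a', by omega, ha'⟩
    refine key a a' j hai hia' ha'n hj.le ha ?_
    have h1 := hγ.dist_eq j (j + 1) hj.le hj
    push_cast at h1
    rw [show (j : ℝ) - (j + 1) = -1 by ring, abs_neg, abs_one] at h1
    have h2 := dist_triangle4_left (p a) (γ j) (p a') (γ (j + 1))
    have h3 := dist_triangle4 (p a) (γ j) (γ (j + 1)) (p a')
    rw [dist_comm (p a) (γ j)] at h3
    linarith

/-- In a hyperbolic space the Gromov product is, up to a bounded error, the distance to a
geodesic. -/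
theorem exists_dist_geodesic_le (M : Type*) [MetricSpace M] [GromovHyperbolic M] :
    ∃ c : ℝ, ∀ (m : ℕ) (γ : ℕ → M) (x y : M), IsGeodesicFromTo γ m x y → ∀ o : M,
      ∃ j ≤ m, dist o (γ j) ≤ gromovProduct o x y + c := by
  obtain ⟨δ, hδ0, hδ⟩ := GromovHyperbolic.exists_nonneg M
  refine ⟨2 * δ + 1, fun m γ x y hγ o => ?_⟩
  have hxy := hγ.dist_ends
  have t1 := dist_triangle x o y
  have t2 := dist_triangle_right x y o
  have t3 := dist_triangle y x o
  have t4 := dist_triangle x y o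
  -- The point of the geodesic at distance about `(o | y)_x` from `x`.
  set r := gromovProduct x o y with hr
  have hr' : 2 * r = dist x o + dist x y - dist o y := by
    rw [hr, gromovProduct, dist_comm o x, dist_comm y x]
    ring
  rw [dist_comm o y] at *
  rw [dist_comm y x] at t3
  have hr0 : 0 ≤ r := by linarith
  have hj1 : (⌊r⌋₊ : ℝ) ≤ r := Nat.floor_le hr0
  have hj2 : r < ⌊r⌋₊ + 1 := Nat.lt_floor_add_one r
  have hjm : ⌊r⌋₊ ≤ m := by
    have : (⌊r⌋₊ : ℝ) ≤ m := by linarith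
    exact_mod_cast this
  refine ⟨⌊r⌋₊, hjm, ?_⟩
  have d1 := hγ.dist_left hjm
  have d2 := hγ.dist_right hjm
  have h := hδ (γ ⌊r⌋₊) x o y
  simp only [gromovProduct, dist_comm o y] at h ⊢
  rw [dist_comm y (γ ⌊r⌋₊)] at h
  rcases min_le_iff.mp (sub_le_iff_le_add.mp h) with h | h <;> linarith

/-- A point `o` of a hyperbolic space is, up to a bounded error, as close to a quasi-geodesic as
the Gromov product of its ends says. -/
theorem exists_dist_quasiGeodesic_le_gromovProduct {M : Type*} [MetricSpace M]
    [GromovHyperbolic M] (hM : IsGraphLike M) {C : ℝ} (hC : 1 ≤ C) :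
    ∃ c : ℝ, ∀ (n : ℕ) (p : ℕ → M), IsQuasiGeodesic C p n → ∀ o : M,
      ∃ i ≤ n, dist o (p i) ≤ gromovProduct o (p 0) (p n) + c := by
  obtain ⟨H, -, hH⟩ := exists_dist_quasiGeodesic_le M hC
  obtain ⟨c, hc⟩ := exists_dist_geodesic_le M
  refine ⟨c + H, fun n p hp o => ?_⟩
  obtain ⟨m, γ, hγ⟩ := hM (p 0) (p n)
  obtain ⟨j, hj, h1⟩ := hc m γ _ _ hγ o
  obtain ⟨i, hi, h2⟩ := hH n p hp m γ hγ j hj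
  exact ⟨i, hi, by linarith [dist_triangle o (γ j) (p i)]⟩

/-! ### Thin triangles -/

/-- Rips' condition: every geodesic triangle is thin. -/
def HasThinTriangles (M : Type*) [MetricSpace M] : Prop :=
  ∃ δ : ℝ, ∀ (x y z : M) (n : ℕ) (γ : ℕ → M), IsGeodesicFromTo γ n x z → ∀ i ≤ n,
    ∃ q : M, dist (γ i) q ≤ δ ∧ (dist x q + dist q y = dist x y ∨ dist y q + dist q z = dist y z)

theorem HasThinTriangles.gromovHyperbolic {M : Type*} [MetricSpace M] (hM : IsGraphLike M)
    (h : HasThinTriangles M) : GromovHyperbolic M := by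
  obtain ⟨δ, hδ⟩ := h
  refine ⟨2 * (δ + 1) + δ, fun o x y z => ?_⟩
  obtain ⟨n, γ, hγ⟩ := hM x z
  -- A point of the side `[x, z]` that is close to both other sides of the triangle `x, o, z`.
  have hmid : ∃ i ≤ n, (∃ u, dist (γ i) u ≤ δ + 1 ∧ dist x u + dist u o = dist x o) ∧
      ∃ v, dist (γ i) v ≤ δ + 1 ∧ dist o v + dist v z = dist o z := by
    have hδ0 : 0 ≤ δ := by
      obtain ⟨q, hq, -⟩ := hδ x o z n γ hγ 0 (Nat.zero_le _)
      exact dist_nonneg.trans hq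
    by_cases hall : ∀ i ≤ n, ∃ u, dist (γ i) u ≤ δ ∧ dist x u + dist u o = dist x o
    · obtain ⟨u, hu, hu'⟩ := hall n le_rfl
      refine ⟨n, le_rfl, ⟨u, by linarith, hu'⟩, z, ?_, by simp⟩
      rw [hγ.last, dist_self]
      linarith
    · push Not at hall
      obtain ⟨i, ⟨hin, hi⟩, hmin⟩ :
          ∃ i, (i ≤ n ∧ ∀ u, dist (γ i) u ≤ δ → dist x u + dist u o ≠ dist x o) ∧
            ∀ j < i, ¬ (j ≤ n ∧ ∀ u, dist (γ j) u ≤ δ → dist x u + dist u o ≠ dist x o) := by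
        classical
        exact ⟨Nat.find hall, Nat.find_spec hall, fun j hj => Nat.find_min hall hj⟩
      obtain ⟨v, hv, hv'⟩ := hδ x o z n γ hγ i hin
      have hv' : dist o v + dist v z = dist o z := hv'.resolve_left (hi v hv)
      refine ⟨i, hin, ?_, v, by linarith, hv'⟩
      rcases i with _ | i
      · refine ⟨x, ?_, by simp⟩
        rw [hγ.zero, dist_self]
        linarith
      · have h1 := hmin i (Nat.lt_succ_self i)
        push Not at h1
        obtain ⟨u, hu, hu'⟩ := h1 (by omega)
        refine ⟨u, ?_, hu'⟩
        have h2 := hγ.dist_eq (i + 1) i hin (by omega)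
        push_cast at h2
        rw [show (i : ℝ) + 1 - i = 1 by ring, abs_one] at h2
        linarith [dist_triangle (γ (i + 1)) (γ i) u]
  obtain ⟨i, hi, ⟨u, hu, hu'⟩, v, hv, hv'⟩ := hmid
  have d1 := hγ.dist_left hi
  have d2 := hγ.dist_right hi
  have d3 := hγ.dist_ends
  have hclose : dist o (γ i) ≤ gromovProduct o x z + 2 * (δ + 1) := by
    have t1 := dist_triangle_right x (γ i) u
    have t2 := dist_triangle_right o (γ i) u
    have t3 := dist_triangle_right o (γ i) v
    have t4 := dist_triangle_left (γ i) z v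
    rw [dist_comm o u] at t2
    rw [dist_comm v (γ i)] at t4
    rw [gromovProduct, dist_comm z o]
    linarith
  obtain ⟨q, hq, hq'⟩ := hδ x y z n γ hγ i hi
  have t := dist_triangle o (γ i) q
  have hmin : min (gromovProduct o x y) (gromovProduct o y z) ≤ dist o q := by
    rcases hq' with hq' | hq'
    · refine (min_le_left _ _).trans ?_
      have t1 := dist_triangle_right x o q
      have t2 := dist_triangle y q o
      rw [dist_comm q o, dist_comm y q] at t2
      simp only [gromovProduct]
      linarith
    · refine (min_le_right _ _).trans ?_
      have t1 := dist_triangle_right y o q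
      have t2 := dist_triangle z q o
      rw [dist_comm q o, dist_comm z q] at t2
      simp only [gromovProduct]
      linarith
  linarith

/-! ### Invariance under quasi-isometric embeddings -/

/-- `f` is a quasi-isometric embedding with constant `C`. The upper bound carries no additive
constant, since the maps of interest are defined on vertex sets of graphs. -/
structure IsQIEmbedding {M N : Type*} [MetricSpace M] [MetricSpace N] (C : ℝ) (f : M → N) :
    Prop where
  one_le : 1 ≤ C
  dist_le : ∀ a b, dist (f a) (f b) ≤ C * dist a b
  le_dist : ∀ a b, dist a b ≤ C * dist (f a) (f b) + C

theorem IsQIEmbedding.isQuasiGeodesic {M N : Type*} [MetricSpace M] [MetricSpace N] {C : ℝ}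
    {f : M → N} (hf : IsQIEmbedding C f) {γ : ℕ → M} {n : ℕ} {x y : M}
    (hγ : IsGeodesicFromTo γ n x y) : IsQuasiGeodesic C (fun i => f (γ i)) n where
  dist_le i j hi hj := by rw [← hγ.dist_eq i j hi hj]; exact hf.dist_le _ _
  le_dist i j hi hj := by rw [← hγ.dist_eq i j hi hj]; exact hf.le_dist _ _

/-- Hyperbolicity passes to quasi-isometrically embedded graphs: by stability of quasi-geodesics,
thin triangles of the target give thin triangles of the source. -/
theorem IsQIEmbedding.gromovHyperbolic {M N : Type*} [MetricSpace M] [MetricSpace N]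
    [GromovHyperbolic N] {C : ℝ} {f : M → N} (hf : IsQIEmbedding C f) (hM : IsGraphLike M)
    (hN : IsGraphLike N) : GromovHyperbolic M := by
  obtain ⟨δ, hδ0, hδ⟩ := GromovHyperbolic.exists_nonneg N
  obtain ⟨H, hH⟩ := exists_gromovProduct_quasiGeodesic_le hN hf.one_le
  obtain ⟨c, hc⟩ := exists_dist_quasiGeodesic_le_gromovProduct hN hf.one_le
  refine HasThinTriangles.gromovHyperbolic hM
    ⟨C * (H + δ + c) + C, fun x y z n γ hγ i hi => ?_⟩
  have hp := hH n _ (hf.isQuasiGeodesic hγ) i hi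
  simp only [hγ.zero, hγ.last] at hp
  have side : ∀ x y : M, gromovProduct (f (γ i)) (f x) (f y) ≤ H + δ →
      ∃ q : M, dist (γ i) q ≤ C * (H + δ + c) + C ∧ dist x q + dist q y = dist x y := by
    intro x y h
    obtain ⟨m, η, hη⟩ := hM x y
    obtain ⟨j, hj, h'⟩ := hc m _ (hf.isQuasiGeodesic hη) (f (γ i))
    simp only [hη.zero, hη.last] at h'
    refine ⟨η j, (hf.le_dist _ _).trans ?_, ?_⟩
    · have := hf.one_le
      gcongr
      linarith
    · rw [hη.dist_left hj, hη.dist_right hj, hη.dist_ends]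
      ring
  rcases min_le_iff.mp (sub_le_iff_le_add.mp ((hδ (f (γ i)) (f x) (f y) (f z)).trans hp)) with
    h | h
  · obtain ⟨q, hq, hq'⟩ := side x y h
    exact ⟨q, hq, Or.inl hq'⟩
  · obtain ⟨q, hq, hq'⟩ := side y z h
    exact ⟨q, hq, Or.inr hq'⟩

/-- Quasi-isometric embeddings into a hyperbolic graph coarsely preserve Gromov products. -/
theorem IsQIEmbedding.exists_gromovProduct_le {M N : Type*} [MetricSpace M] [MetricSpace N]
    [GromovHyperbolic N] {C : ℝ} {f : M → N} (hf : IsQIEmbedding C f) (hM : IsGraphLike M)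
    (hN : IsGraphLike N) :
    ∃ c : ℝ, ∀ o x y : M,
      gromovProduct o x y ≤ C * gromovProduct (f o) (f x) (f y) + c ∧
      gromovProduct (f o) (f x) (f y) ≤ C * gromovProduct o x y + c := by
  have := hf.gromovHyperbolic hM hN
  obtain ⟨H, hH⟩ := exists_gromovProduct_quasiGeodesic_le hN hf.one_le
  obtain ⟨c, hc⟩ := exists_dist_quasiGeodesic_le_gromovProduct hN hf.one_le
  obtain ⟨c', hc'⟩ := exists_dist_geodesic_le M
  have hC := hf.one_le
  refine ⟨max (C * c + C) (C * c' + H), fun o x y => ?_⟩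
  obtain ⟨n, γ, hγ⟩ := hM x y
  have hq := hf.isQuasiGeodesic hγ
  constructor
  · obtain ⟨i, hi, h⟩ := hc n _ hq (f o)
    simp only [hγ.zero, hγ.last] at h
    have h1 := hγ.gromovProduct_le hi o
    have h2 := hf.le_dist o (γ i)
    have h3 : C * dist (f o) (f (γ i)) ≤ C * (gromovProduct (f o) (f x) (f y) + c) := by gcongr
    linarith [le_max_left (C * c + C) (C * c' + H)]
  · obtain ⟨i, hi, h⟩ := hc' n γ x y hγ o
    have h1 := hH n _ hq i hi
    simp only [hγ.zero, hγ.last] at h1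
    have h2 := hf.dist_le o (γ i)
    have h3 := gromovProduct_base_le (f o) (f (γ i)) (f x) (f y)
    have h4 : C * dist o (γ i) ≤ C * (gromovProduct o x y + c') := by gcongr
    linarith [le_max_right (C * c + C) (C * c' + H)]

theorem IsQIEmbedding.comp {M N P : Type*} [MetricSpace M] [MetricSpace N] [MetricSpace P]
    {C D : ℝ} {f : M → N} {g : N → P} (hg : IsQIEmbedding D g) (hf : IsQIEmbedding C f) :
    IsQIEmbedding (C * D + C) (g ∘ f) := by
  have hC := hf.one_le
  have hD := hg.one_le
  refine ⟨by nlinarith, fun a b => ?_, fun a b => ?_⟩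
  · have h1 : D * dist (f a) (f b) ≤ D * (C * dist a b) := by
      have := hf.dist_le a b
      gcongr
    have h2 : 0 ≤ C * dist a b := by positivity
    have h3 := hg.dist_le (f a) (f b)
    simp only [Function.comp]
    linarith
  · have h1 : C * dist (f a) (f b) ≤ C * (D * dist (g (f a)) (g (f b)) + D) := by
      have := hg.le_dist (f a) (f b)
      gcongr
    have h2 : 0 ≤ C * dist (g (f a)) (g (f b)) := by positivity
    have h3 := hf.le_dist a b
    simp only [Function.comp]
    linarith

/-! ### Convergence to infinity and the boundary map -/

theorem GromovConverge.of_dist_le {M : Type*} [MetricSpace M] {x x' y : ℕ → M}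
    (h : GromovConverge x y) (B : ℝ) (hB : ∀ n, dist (x n) (x' n) ≤ B) : GromovConverge x' y := by
  intro o
  refine tendsto_atTop_mono (fun p => ?_) (tendsto_atTop_add_const_right _ (-B) (h o))
  linarith [gromovProduct_left_le o (x p.1) (x' p.1) (y p.2), hB p.1]

theorem GromovConverge.comp {M : Type*} [MetricSpace M] {x y : ℕ → M} (h : GromovConverge x y)
    {φ ψ : ℕ → ℕ} (hφ : Tendsto φ atTop atTop) (hψ : Tendsto ψ atTop atTop) :
    GromovConverge (fun n => x (φ n)) (fun n => y (ψ n)) :=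
  fun o => (h o).comp (hφ.prodMap hψ)

theorem IsQIEmbedding.gromovConverge_iff {M N : Type*} [MetricSpace M] [MetricSpace N]
    [GromovHyperbolic N] {C : ℝ} {f : M → N} (hf : IsQIEmbedding C f) (hM : IsGraphLike M)
    (hN : IsGraphLike N) (x y : ℕ → M) :
    GromovConverge (fun n => f (x n)) (fun n => f (y n)) ↔ GromovConverge x y := by
  obtain ⟨c, hc⟩ := hf.exists_gromovProduct_le hM hN
  have hC : 0 < C := by linarith [hf.one_le]
  constructor
  · intro h o
    refine tendsto_atTop_mono (fun p => ?_)
      ((tendsto_atTop_add_const_right _ (-c) (h (f o))).atTop_div_const hC)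
    rw [div_le_iff₀' hC]
    linarith [(hc o (x p.1) (y p.2)).2]
  · intro h o
    have h1 := tendsto_atTop_add_const_right _ (-dist (f (x 0)) o)
      ((tendsto_atTop_add_const_right _ (-c) (h (x 0))).atTop_div_const hC)
    refine tendsto_atTop_mono (fun p => ?_) h1
    have h2 : (gromovProduct (x 0) (x p.1) (y p.2) + -c) / C ≤
        gromovProduct (f (x 0)) (f (x p.1)) (f (y p.2)) := by
      rw [div_le_iff₀' hC]
      linarith [(hc (x 0) (x p.1) (y p.2)).1]
    linarith [gromovProduct_base_le (f (x 0)) o (f (x p.1)) (f (y p.2))]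

/-- The map between boundaries at infinity induced by a quasi-isometric embedding. -/
def IsQIEmbedding.boundaryMap {M N : Type*} [MetricSpace M] [MetricSpace N]
    [GromovHyperbolic M] [GromovHyperbolic N] {C : ℝ} {f : M → N} (hf : IsQIEmbedding C f)
    (hM : IsGraphLike M) (hN : IsGraphLike N) : GromovBoundary M → GromovBoundary N :=
  Quotient.map (fun s => ⟨fun n => f (s.1 n), (hf.gromovConverge_iff hM hN _ _).mpr s.2⟩)
    (fun s t h => (hf.gromovConverge_iff hM hN s.1 t.1).mpr h)

theorem IsQIEmbedding.boundaryMap_injective {M N : Type*} [MetricSpace M] [MetricSpace N]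
    [GromovHyperbolic M] [GromovHyperbolic N] {C : ℝ} {f : M → N} (hf : IsQIEmbedding C f)
    (hM : IsGraphLike M) (hN : IsGraphLike N) :
    Function.Injective (hf.boundaryMap hM hN) := by
  rintro ⟨s⟩ ⟨t⟩ h
  exact Quotient.sound ((hf.gromovConverge_iff hM hN s.1 t.1).mp (Quotient.exact h))

/-! ### Loxodromic elements and their endpoints -/

/-- The limits of `g ^ n • o` as `n → +∞`, over all base points `o` for which the limit exists. -/
def forwardLimits {G : Type*} [Group G] (M : Type*) [MetricSpace M] [GromovHyperbolic M]
    [MulAction G M] (g : G) : Set (GromovBoundary M) :=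
  {ξ | ∃ (o : M) (s : GromovSeq M), Quotient.mk (gromovSetoid M) s = ξ ∧
    ∀ n : ℕ, s.1 n = g ^ n • o}

theorem endpoints_eq_union {G : Type*} [Group G] (M : Type*) [MetricSpace M]
    [GromovHyperbolic M] [MulAction G M] (g : G) :
    endpoints M g = forwardLimits M g ∪ forwardLimits M g⁻¹ := by
  ext ξ
  constructor
  · rintro ⟨o, s, hs, h | h⟩
    · exact Or.inl ⟨o, s, hs, h⟩
    · exact Or.inr ⟨o, s, hs, h⟩
  · rintro (⟨o, s, hs, h⟩ | ⟨o, s, hs, h⟩)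
    · exact ⟨o, s, hs, Or.inl h⟩
    · exact ⟨o, s, hs, Or.inr h⟩

theorem forwardLimits_pow {G : Type*} [Group G] (M : Type*) [MetricSpace M] [GromovHyperbolic M]
    [MulAction G M] [IsIsometricSMul G M] (g : G) {k : ℕ} (hk : 0 < k) :
    forwardLimits M (g ^ k) = forwardLimits M g := by
  have hmul : Tendsto (fun n : ℕ => k * n) atTop atTop := tendsto_id.const_mul_atTop' hk
  have hdiv : Tendsto (fun n : ℕ => n / k) atTop atTop := Nat.tendsto_div_const_atTop hk.ne'
  ext ξ
  constructor
  · rintro ⟨o, s, rfl, hs⟩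
    -- `g ^ n • o` stays within bounded distance of `(g ^ k) ^ (n / k) • o`.
    have hB : ∀ n, dist (s.1 (n / k)) (g ^ n • o) ≤ ∑ r ∈ Finset.range k, dist o (g ^ r • o) := by
      intro n
      rw [hs, ← pow_mul]
      nth_rewrite 2 [← Nat.div_add_mod n k]
      rw [pow_add, mul_smul, dist_smul]
      exact Finset.single_le_sum (f := fun r => dist o (g ^ r • o)) (fun _ _ => dist_nonneg)
        (Finset.mem_range.mpr (Nat.mod_lt n hk))
    have h1 : GromovConverge (fun n => g ^ n • o) s.1 :=
      (s.2.comp hdiv tendsto_id).of_dist_le _ hB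
    have h2 : GromovConverge (fun n => g ^ n • o) (fun n => g ^ n • o) :=
      (h1.symm.comp hdiv tendsto_id).of_dist_le _ hB
    exact ⟨o, ⟨_, h2⟩, Quotient.sound h1, fun n => rfl⟩
  · rintro ⟨o, s, rfl, hs⟩
    refine ⟨o, ⟨fun n => s.1 (k * n), s.2.comp hmul hmul⟩,
      Quotient.sound (s.2.comp hmul tendsto_id), fun n => ?_⟩
    simp only [hs, pow_mul]

theorem endpoints_pow {G : Type*} [Group G] (M : Type*) [MetricSpace M] [GromovHyperbolic M]
    [MulAction G M] [IsIsometricSMul G M] (g : G) {k : ℕ} (hk : 0 < k) :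
    endpoints M (g ^ k) = endpoints M g := by
  rw [endpoints_eq_union, endpoints_eq_union, ← inv_pow, forwardLimits_pow M g hk,
    forwardLimits_pow M g⁻¹ hk]

theorem IsLoxodromic.pow {G : Type*} [Group G] {M : Type*} [MetricSpace M] [MulAction G M] {g : G}
    (h : IsLoxodromic M g) {k : ℕ} (hk : 0 < k) : IsLoxodromic M (g ^ k) := by
  obtain ⟨o, K, C, hK, h⟩ := h
  have hk1 : (1 : ℝ) ≤ k := by exact_mod_cast hk
  refine ⟨o, K * k, C, by positivity, fun m n => ?_⟩
  obtain ⟨h1, h2⟩ := h (k * m) (k * n)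
  rw [zpow_mul, zpow_mul, zpow_natCast] at h1 h2
  push_cast at h1 h2
  rw [← mul_sub, abs_mul, abs_of_nonneg (by linarith : (0 : ℝ) ≤ k)] at h1 h2
  refine ⟨?_, by linarith⟩
  have h3 : |(m : ℝ) - n| / (K * k) ≤ k * |(m : ℝ) - n| / K := by
    rw [div_le_div_iff₀ (by positivity) hK]
    have h0 : 0 ≤ |(m : ℝ) - n| * K := by positivity
    have h4 : 1 ≤ (k : ℝ) * k := by nlinarith
    linarith [mul_le_mul_of_nonneg_left h4 h0]
  linarith

/-- Being loxodromic may be tested on any orbit. -/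
theorem IsLoxodromic.exists_of_base {G : Type*} [Group G] {M : Type*} [MetricSpace M]
    [MulAction G M] [IsIsometricSMul G M] {g : G} (h : IsLoxodromic M g) (o : M) :
    ∃ K C : ℝ, 0 < K ∧ ∀ m n : ℤ, |(m : ℝ) - n| / K - C ≤ dist (g ^ m • o) (g ^ n • o) ∧
      dist (g ^ m • o) (g ^ n • o) ≤ K * |(m : ℝ) - n| + C := by
  obtain ⟨o', K, C, hK, h⟩ := h
  refine ⟨K, C + 2 * dist o o', hK, fun m n => ?_⟩
  obtain ⟨h1, h2⟩ := h m n
  have t1 := dist_triangle4 (g ^ m • o) (g ^ m • o') (g ^ n • o') (g ^ n • o)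
  have t2 := dist_triangle4 (g ^ m • o') (g ^ m • o) (g ^ n • o) (g ^ n • o')
  simp only [dist_smul, dist_comm o' o] at t1 t2
  constructor <;> linarith

theorem IsQIEmbedding.isLoxodromic_iff {G H M N : Type*} [Group G] [Group H] [MetricSpace M]
    [MetricSpace N] [MulAction G M] [MulAction H N] [IsIsometricSMul G M] [IsIsometricSMul H N]
    {C : ℝ} {f : M → N} (hf : IsQIEmbedding C f) (ι : G →* H)
    (hequiv : ∀ g x, f (g • x) = ι g • f x) [Nonempty M] (g : G) :
    IsLoxodromic N (ι g) ↔ IsLoxodromic M g := by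
  obtain ⟨o⟩ := ‹Nonempty M›
  have hC := hf.one_le
  have hC0 : 0 < C := by linarith
  have hCC : C ≤ C * C := by nlinarith
  have hz : ∀ m n : ℤ, dist (ι g ^ m • f o) (ι g ^ n • f o) =
      dist (f (g ^ m • o)) (f (g ^ n • o)) := by
    intro m n
    rw [hequiv, hequiv, map_zpow, map_zpow]
  constructor
  · intro h
    obtain ⟨K, D, hK, h⟩ := h.exists_of_base (f o)
    refine ⟨o, C * K, C * |D| + C, by positivity, fun m n => ?_⟩
    obtain ⟨h1, h2⟩ := h m n
    rw [hz] at h1 h2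
    have h3 := hf.dist_le (g ^ m • o) (g ^ n • o)
    have h4 := hf.le_dist (g ^ m • o) (g ^ n • o)
    have hD := le_abs_self D
    have hD0 : |D| ≤ C * C * |D| := le_mul_of_one_le_left (abs_nonneg D) (hC.trans hCC)
    have hD1 : |D| ≤ C * |D| := le_mul_of_one_le_left (abs_nonneg D) hC
    constructor
    · rw [← div_div, div_right_comm, sub_le_iff_le_add, div_le_iff₀' hC0]
      nlinarith
    · have : C * dist (f (g ^ m • o)) (f (g ^ n • o)) ≤ C * (K * |(m : ℝ) - n| + D) := by gcongr
      nlinarith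
  · intro h
    obtain ⟨K, D, hK, h⟩ := h.exists_of_base o
    refine ⟨f o, C * K, C * |D| + C, by positivity, fun m n => ?_⟩
    obtain ⟨h1, h2⟩ := h m n
    rw [hz]
    have h3 := hf.dist_le (g ^ m • o) (g ^ n • o)
    have h4 := hf.le_dist (g ^ m • o) (g ^ n • o)
    have hD := le_abs_self D
    have hD0 : |D| ≤ C * C * |D| := le_mul_of_one_le_left (abs_nonneg D) (hC.trans hCC)
    have hD1 : |D| ≤ C * |D| := le_mul_of_one_le_left (abs_nonneg D) hC
    constructor
    · rw [← div_div, div_right_comm, sub_le_iff_le_add, div_le_iff₀' hC0]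
      nlinarith
    · have : C * dist (g ^ m • o) (g ^ n • o) ≤ C * (K * |(m : ℝ) - n| + D) := by gcongr
      nlinarith

theorem IsQIEmbedding.forwardLimits_eq_image {G H M N : Type*} [Group G] [Group H]
    [MetricSpace M] [MetricSpace N] [GromovHyperbolic M] [GromovHyperbolic N] [MulAction G M]
    [MulAction H N] [IsIsometricSMul H N] {C : ℝ} {f : M → N}
    (hf : IsQIEmbedding C f) (hM : IsGraphLike M) (hN : IsGraphLike N) (ι : G →* H)
    (hequiv : ∀ g x, f (g • x) = ι g • f x) [Nonempty M] (g : G) :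
    forwardLimits N (ι g) = hf.boundaryMap hM hN '' forwardLimits M g := by
  ext ξ
  constructor
  · rintro ⟨o, s, rfl, hs⟩
    obtain ⟨o'⟩ := ‹Nonempty M›
    -- The orbit of any point of the image is at constant distance from the orbit of `o`.
    have hB : ∀ n, dist (s.1 n) (f (g ^ n • o')) ≤ dist o (f o') := by
      intro n
      rw [hs, hequiv, map_pow, dist_smul]
    have h1 : GromovConverge (fun n => f (g ^ n • o')) s.1 := s.2.of_dist_le _ hB
    have h2 : GromovConverge (fun n => f (g ^ n • o')) (fun n => f (g ^ n • o')) :=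
      h1.symm.of_dist_le _ hB
    exact ⟨_, ⟨o', ⟨_, (hf.gromovConverge_iff hM hN _ _).mp h2⟩, rfl, fun n => rfl⟩,
      Quotient.sound h1⟩
  · rintro ⟨_, ⟨o, s, rfl, hs⟩, rfl⟩
    refine ⟨f o, ⟨fun n => f (s.1 n), (hf.gromovConverge_iff hM hN _ _).mpr s.2⟩, rfl,
      fun n => ?_⟩
    simp only [hs, hequiv, map_pow]

theorem IsQIEmbedding.endpoints_eq_image {G H M N : Type*} [Group G] [Group H]
    [MetricSpace M] [MetricSpace N] [GromovHyperbolic M] [GromovHyperbolic N] [MulAction G M]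
    [MulAction H N] [IsIsometricSMul H N] {C : ℝ} {f : M → N}
    (hf : IsQIEmbedding C f) (hM : IsGraphLike M) (hN : IsGraphLike N) (ι : G →* H)
    (hequiv : ∀ g x, f (g • x) = ι g • f x) [Nonempty M] (g : G) :
    endpoints N (ι g) = hf.boundaryMap hM hN '' endpoints M g := by
  rw [endpoints_eq_union, endpoints_eq_union, Set.image_union, ← map_inv,
    hf.forwardLimits_eq_image hM hN ι hequiv, hf.forwardLimits_eq_image hM hN ι hequiv]

/-! ### Labels and subgroups of finite index -/

theorem isBounded_orbit_of_finiteIndex {H N : Type*} [Group H] [MetricSpace N] [MulAction H N]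
    [IsIsometricSMul H N] (K : Subgroup H) [K.FiniteIndex] (o : N)
    (h : Bornology.IsBounded (MulAction.orbit K o)) :
    Bornology.IsBounded (MulAction.orbit H o) := by
  have : Finite (H ⧸ K) := Subgroup.finite_quotient_of_finiteIndex
  refine Bornology.IsBounded.subset (Bornology.isBounded_iUnion.mpr fun q : H ⧸ K =>
    (isometry_smul N q.out).lipschitz.isBounded_image h) ?_
  rintro _ ⟨x, rfl⟩
  refine Set.mem_iUnion.mpr ⟨(x : H ⧸ K), _, ⟨⟨(x : H ⧸ K).out⁻¹ * x, ?_⟩, rfl⟩, ?_⟩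
  · rw [← QuotientGroup.eq, QuotientGroup.out_eq']
  · change (x : H ⧸ K).out • (((x : H ⧸ K).out⁻¹ * x) • o) = x • o
    rw [smul_smul, mul_inv_cancel_left]

theorem IsQIEmbedding.isBounded_orbits_iff {G H M N : Type*} [Group G] [Group H] [MetricSpace M]
    [MetricSpace N] [MulAction G M] [MulAction H N] [IsIsometricSMul H N]
    {C : ℝ} {f : M → N} (hf : IsQIEmbedding C f) (ι : G →* H) [ι.range.FiniteIndex]
    (hequiv : ∀ g x, f (g • x) = ι g • f x) [Nonempty M] :
    (∀ o : N, Bornology.IsBounded (MulAction.orbit H o)) ↔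
      ∀ o : M, Bornology.IsBounded (MulAction.orbit G o) := by
  have hC := hf.one_le
  constructor
  · intro h o
    obtain ⟨B, hB⟩ := Metric.isBounded_iff.mp (h (f o))
    refine Metric.isBounded_iff.mpr ⟨C * B + C, ?_⟩
    rintro _ ⟨a, rfl⟩ _ ⟨b, rfl⟩
    refine (hf.le_dist _ _).trans ?_
    have := hB ⟨ι a, rfl⟩ ⟨ι b, rfl⟩
    simp only [hequiv]
    gcongr
  · intro h o
    apply isBounded_orbit_of_finiteIndex ι.range
    obtain ⟨o'⟩ := ‹Nonempty M›
    obtain ⟨B, hB⟩ := Metric.isBounded_iff.mp (h o')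
    refine Metric.isBounded_iff.mpr ⟨C * B + 2 * dist o (f o'), ?_⟩
    rintro _ ⟨⟨_, a, rfl⟩, rfl⟩ _ ⟨⟨_, b, rfl⟩, rfl⟩
    change dist (ι a • o) (ι b • o) ≤ _
    have h1 := (hf.dist_le (a • o') (b • o')).trans
      (mul_le_mul_of_nonneg_left (hB ⟨a, rfl⟩ ⟨b, rfl⟩) (by linarith))
    rw [hequiv, hequiv] at h1
    have h2 := dist_triangle4 (ι a • o) (ι a • f o') (ι b • f o') (ι b • o)
    simp only [dist_smul, dist_comm (f o') o] at h2
    linarith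

/-- An equivariant quasi-isometric embedding preserves labels when the smaller group has finite
index in the larger one: every loxodromic element of the larger group has a power in the smaller
one, which is loxodromic with the same endpoints. -/
theorem IsQIEmbedding.actionHasLabel_iff {G H M N : Type*} [Group G] [Group H]
    [MetricSpace M] [MetricSpace N] [GromovHyperbolic M] [GromovHyperbolic N] [MulAction G M]
    [MulAction H N] [IsIsometricSMul G M] [IsIsometricSMul H N] {C : ℝ} {f : M → N}
    (hf : IsQIEmbedding C f) (hM : IsGraphLike M) (hN : IsGraphLike N) (ι : G →* H)
    [ι.range.FiniteIndex] (hequiv : ∀ g x, f (g • x) = ι g • f x) [Nonempty M]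
    (l : ActionLabel) : ActionHasLabel G M l ↔ ActionHasLabel H N l := by
  have hbdd := hf.isBounded_orbits_iff ι hequiv
  have hend := hf.endpoints_eq_image hM hN ι hequiv
  have hlox := hf.isLoxodromic_iff ι hequiv
  have hinj := hf.boundaryMap_injective hM hN
  have hpow : ∀ h : H, IsLoxodromic N h →
      ∃ g : G, IsLoxodromic M g ∧ endpoints N h = hf.boundaryMap hM hN '' endpoints M g := by
    intro h hh
    obtain ⟨k, hk, -, g, hg⟩ := Subgroup.exists_pow_mem_of_index_ne_zero
      (Subgroup.FiniteIndex.index_ne_zero (H := ι.range)) h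
    refine ⟨g, ?_, ?_⟩
    · rw [← hlox, hg]
      exact hh.pow hk
    · rw [← hend, hg, endpoints_pow N h hk]
  have hex : (∃ g : G, IsLoxodromic M g) ↔ ∃ h : H, IsLoxodromic N h :=
    ⟨fun ⟨g, hg⟩ => ⟨ι g, (hlox g).mpr hg⟩, fun ⟨h, hh⟩ => (hpow h hh).imp fun _ hg => hg.1⟩
  have hlin : IsLinealAction G M ↔ IsLinealAction H N := by
    refine and_congr hex ⟨fun h a b ha hb => ?_, fun h a b ha hb => ?_⟩
    · obtain ⟨a', ha', ha''⟩ := hpow a ha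
      obtain ⟨b', hb', hb''⟩ := hpow b hb
      rw [ha'', hb'', h a' b' ha' hb']
    · have := h (ι a) (ι b) ((hlox a).mpr ha) ((hlox b).mpr hb)
      rw [hend, hend] at this
      exact hinj.image_injective this
  cases l with
  | bounded => exact hbdd.symm
  | horocyclic => exact and_congr (not_congr hbdd.symm) (not_congr hex)
  | lineal => exact hlin
  | focal =>
    refine and_congr hex (and_congr (not_congr hlin) ⟨fun h a b ha hb => ?_, fun h a b ha hb => ?_⟩)
    · obtain ⟨a', ha', ha''⟩ := hpow a ha
      obtain ⟨b', hb', hb''⟩ := hpow b hb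
      rw [ha'', hb'', ← Set.image_inter hinj]
      exact (h a' b' ha' hb').image _
    · have := h (ι a) (ι b) ((hlox a).mpr ha) ((hlox b).mpr hb)
      rw [hend, hend, ← Set.image_inter hinj] at this
      exact this.of_image
  | generalType =>
    constructor
    · rintro ⟨a, b, ha, hb, hab⟩
      refine ⟨ι a, ι b, (hlox a).mpr ha, (hlox b).mpr hb, ?_⟩
      rw [hend, hend]
      exact (Set.disjoint_image_iff hinj).mpr hab
    · rintro ⟨a, b, ha, hb, hab⟩
      obtain ⟨a', ha', ha''⟩ := hpow a ha
      obtain ⟨b', hb', hb''⟩ := hpow b hb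
      refine ⟨a', b', ha', hb', ?_⟩
      rw [ha'', hb''] at hab
      exact (Set.disjoint_image_iff hinj).mp hab

/-! ### Cayley graphs -/

theorem Cayl.isGraphLike {G : Type*} [Group G] (X : GenSet G) : IsGraphLike (Cayl X) := by
  intro (x : G) (y : G)
  obtain ⟨p, hp⟩ := X.connected.exists_walk_length_eq_dist x y
  -- Consecutive vertices of a walk are at distance at most one, so a walk of minimal length is a
  -- geodesic.
  have hle : ∀ i k : ℕ, (SimpleGraph.mulCayley X.carrier).dist (p.getVert i) (p.getVert (i + k))
      ≤ k := by
    intro i k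
    induction k with
    | zero => simp
    | succ k ih =>
      refine (X.connected.dist_triangle (v := p.getVert (i + k))).trans (add_le_add ih ?_)
      by_cases h : i + k < p.length
      · exact (SimpleGraph.dist_eq_one_iff_adj.mpr (p.adj_getVert_succ h)).le
      · rw [p.getVert_of_length_le (not_lt.mp h), p.getVert_of_length_le (by omega)]
        simp
  have heq : ∀ i j : ℕ, i ≤ j → j ≤ p.length →
      (SimpleGraph.mulCayley X.carrier).dist (p.getVert i) (p.getVert j) = j - i := by
    intro i j hij hj
    have h1 := hle 0 i
    have h2 := hle i (j - i)
    have h3 := hle j (p.length - j)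
    rw [zero_add, p.getVert_zero] at h1
    rw [Nat.add_sub_cancel' hij] at h2
    rw [Nat.add_sub_cancel' hj, p.getVert_length] at h3
    have t1 := X.connected.dist_triangle (u := x) (v := p.getVert i) (w := y)
    have t2 := X.connected.dist_triangle (u := p.getVert i) (v := p.getVert j) (w := y)
    omega
  refine ⟨p.length, p.getVert, p.getVert_zero, p.getVert_length, fun i j hi hj => ?_⟩
  change ((SimpleGraph.mulCayley X.carrier).dist (p.getVert i) (p.getVert j) : ℝ) = _
  rcases le_total i j with h | h
  · rw [heq i j h hj, Nat.cast_sub h, abs_sub_comm, abs_of_nonneg]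
    simpa using h
  · rw [SimpleGraph.dist_comm, heq j i h hi, Nat.cast_sub h, abs_of_nonneg]
    simpa using h

theorem GenSet.dist_eq_wordLength {G : Type*} [Group G] (X : GenSet G) (a b : G) :
    (SimpleGraph.mulCayley X.carrier).dist a b = X.wordLength (a⁻¹ * b) := by
  rw [← X.dist_mul a, mul_inv_cancel_left]

theorem GenSet.wordLength_mul_le {G : Type*} [Group G] (X : GenSet G) (a b : G) :
    X.wordLength (a * b) ≤ X.wordLength a + X.wordLength b := by
  rw [← X.dist_mul a b]
  exact X.connected.dist_triangle

/-- A map between groups that moves the ends of every edge of `Cayl(G, X)` to points at distance at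
most `C` is `C`-Lipschitz. -/
theorem GenSet.dist_le_mul_dist {G H : Type*} [Group G] [Group H] (X : GenSet G) (Y : GenSet H)
    (f : G → H) (C : ℕ)
    (h : ∀ a, ∀ x ∈ X.carrier, (SimpleGraph.mulCayley Y.carrier).dist (f a) (f (a * x)) ≤ C)
    (a b : G) : (SimpleGraph.mulCayley Y.carrier).dist (f a) (f b) ≤
      C * (SimpleGraph.mulCayley X.carrier).dist a b := by
  obtain ⟨p, hp⟩ := X.connected.exists_walk_length_eq_dist a b
  rw [← hp]
  clear hp
  induction p with
  | nil => simp
  | @cons a b c hab p ih =>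
    have h1 : (SimpleGraph.mulCayley Y.carrier).dist (f a) (f b) ≤ C := by
      rw [SimpleGraph.mulCayley_adj] at hab
      rcases hab.2 with h2 | h2
      · simpa using h a _ h2
      · rw [SimpleGraph.dist_comm]
        simpa using h b _ h2
    have h3 := Y.connected.dist_triangle (u := f a) (v := f b) (w := f c)
    rw [SimpleGraph.Walk.length_cons, mul_add, mul_one]
    omega

theorem GenSet.exists_isQIEmbedding {G H : Type*} [Group G] [Group H] (X : GenSet G)
    (Y : GenSet H) (f : G → H) (C D : ℕ)
    (h : ∀ a b, (SimpleGraph.mulCayley Y.carrier).dist (f a) (f b) ≤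
      C * (SimpleGraph.mulCayley X.carrier).dist a b)
    (h' : ∀ a b, (SimpleGraph.mulCayley X.carrier).dist a b ≤
      D * (SimpleGraph.mulCayley Y.carrier).dist (f a) (f b) + D) :
    ∃ K : ℝ, IsQIEmbedding (M := Cayl X) (N := Cayl Y) K f := by
  refine ⟨C + D + 1, ?_, fun (a : G) (b : G) => ?_, fun (a : G) (b : G) => ?_⟩
  · linarith [(Nat.cast_nonneg C : (0 : ℝ) ≤ C), (Nat.cast_nonneg D : (0 : ℝ) ≤ D)]
  · change ((SimpleGraph.mulCayley Y.carrier).dist (f a) (f b) : ℝ) ≤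
      (C + D + 1) * ((SimpleGraph.mulCayley X.carrier).dist a b : ℝ)
    norm_cast
    nlinarith [h a b]
  · change ((SimpleGraph.mulCayley X.carrier).dist a b : ℝ) ≤
      (C + D + 1) * ((SimpleGraph.mulCayley Y.carrier).dist (f a) (f b) : ℝ) + (C + D + 1)
    norm_cast
    nlinarith [h' a b]

/-- Equivalent generating sets have quasi-isometric Cayley graphs. -/
theorem GenSet.exists_isQIEmbedding_id {G : Type*} [Group G] {X Y : GenSet G} (h : X ≤ Y)
    (h' : Y ≤ X) : ∃ K : ℝ, IsQIEmbedding (M := Cayl X) (N := Cayl Y) K (id : G → G) := by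
  obtain ⟨C, hC⟩ := h'
  obtain ⟨D, hD⟩ := h
  refine GenSet.exists_isQIEmbedding X Y id C D (fun a b => ?_) (fun a b => ?_)
  · rw [id, id, Y.dist_eq_wordLength, X.dist_eq_wordLength]
    exact Y.wordLength_le_mul X C hC _
  · rw [id, id, Y.dist_eq_wordLength, X.dist_eq_wordLength]
    exact (X.wordLength_le_mul Y D hD _).trans (Nat.le_add_right _ _)

/-! ### The generating set `X ∪ F` of the semidirect product -/

theorem GenSet.wordLength_union_inl_le {G : Type*} [Group G] (X : GenSet G)
    (F : Subgroup (MulAut G)) (g : G) :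
    (X.union F).wordLength (SemidirectProduct.inl g) ≤ X.wordLength g := by
  have h := X.dist_le_mul_dist (X.union F) SemidirectProduct.inl 1 (fun a x hx => by
    rw [map_mul, GenSet.dist_mul]
    exact GenSet.wordLength_le_of_mem _ (Or.inl ⟨x, hx, rfl⟩)) 1 g
  simpa [GenSet.wordLength] using h

theorem GenSet.wordLength_union_inr_le {G : Type*} [Group G] (X : GenSet G)
    (F : Subgroup (MulAut G)) (φ : F) :
    (X.union F).wordLength (SemidirectProduct.inr φ) ≤ 1 :=
  GenSet.wordLength_le_of_mem _ (Or.inr ⟨φ, rfl⟩)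

theorem GenSet.union_mono {G : Type*} [Group G] {X Y : GenSet G} (F : Subgroup (MulAut G))
    (h : X ≤ Y) : X.union F ≤ Y.union F := by
  obtain ⟨C, hC⟩ := h
  refine ⟨C + 1, ?_⟩
  rintro _ (⟨y, hy, rfl⟩ | ⟨φ, rfl⟩)
  · exact ((X.wordLength_union_inl_le F y).trans (hC y hy)).trans (Nat.le_succ C)
  · exact (X.wordLength_union_inr_le F φ).trans (Nat.le_add_left 1 C)

theorem GenSet.dist_union_le {G : Type*} [Group G] (X : GenSet G) (F : Subgroup (MulAut G))
    (a b : AutSemidirect F) :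
    (SimpleGraph.mulCayley (X.union F).carrier).dist a b ≤
      (SimpleGraph.mulCayley X.carrier).dist a.left b.left + 2 := by
  have key : ∀ a : AutSemidirect F,
      (SimpleGraph.mulCayley (X.union F).carrier).dist (SemidirectProduct.inl a.left) a ≤ 1 := by
    intro a
    have h := (X.union F).dist_mul (SemidirectProduct.inl a.left) (SemidirectProduct.inr a.right)
    rw [SemidirectProduct.inl_left_mul_inr_right] at h
    rw [h]
    exact X.wordLength_union_inr_le F _
  have h1 := key a
  have h2 := key b
  have h3 := X.wordLength_union_inl_le F (a.left⁻¹ * b.left)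
  rw [map_mul, map_inv, ← GenSet.dist_eq_wordLength, ← GenSet.dist_eq_wordLength] at h3
  have t1 := (X.union F).connected.dist_triangle (u := a) (v := SemidirectProduct.inl a.left)
    (w := b)
  have t2 := (X.union F).connected.dist_triangle (u := SemidirectProduct.inl a.left)
    (v := SemidirectProduct.inl b.left) (w := b)
  rw [SimpleGraph.dist_comm] at h1
  omega

/-- The automorphisms in `F` distort `X`-lengths by a bounded factor, uniformly in `F`. -/
def GenSet.IsCoarselyInvariant {G : Type*} [Group G] (X : GenSet G)
    (F : Subgroup (MulAut G)) : Prop :=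
  ∃ C : ℕ, ∀ φ ∈ F, ∀ x ∈ X.carrier, X.wordLength (φ x) ≤ C

theorem HypGenSet.isCoarselyInvariant {G : Type*} [Group G] (F : Subgroup (MulAut G)) [Finite F]
    (X : HypGenSet G) (hX : ∀ φ ∈ F, HypStructure.map φ X.toStructure = X.toStructure) :
    X.1.IsCoarselyInvariant F := by
  have h : ∀ φ : F, ∃ C : ℕ, ∀ x ∈ X.1.carrier, X.1.wordLength (φ.1 x) ≤ C := by
    intro φ
    have h1 : toAntisymmetrization (· ≤ ·) (HypGenSet.map φ.1 X) =
        toAntisymmetrization (· ≤ ·) X := hX φ.1 φ.2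
    obtain ⟨C, hC⟩ := toAntisymmetrization_le_toAntisymmetrization_iff.mp h1.ge
    exact ⟨C, fun x hx => hC _ ⟨x, hx, rfl⟩⟩
  choose C hC using h
  obtain ⟨B, hB⟩ := (Set.finite_range C).bddAbove
  exact ⟨B, fun φ hφ x hx => (hC ⟨φ, hφ⟩ x hx).trans (hB ⟨_, rfl⟩)⟩

/-- The projection `G ⋊ F → G` is not a homomorphism, but it is Lipschitz: in a word in `X ∪ F` the
letters from `F` can be moved to the right, at the cost of replacing every letter `x` from `X` by
some `φ x`. -/
theorem GenSet.IsCoarselyInvariant.exists_dist_left_le {G : Type*} [Group G] {X : GenSet G}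
    {F : Subgroup (MulAut G)} (hX : X.IsCoarselyInvariant F) :
    ∃ C : ℕ, ∀ a b : AutSemidirect F, (SimpleGraph.mulCayley X.carrier).dist a.left b.left ≤
      C * (SimpleGraph.mulCayley (X.union F).carrier).dist a b := by
  obtain ⟨C, hC⟩ := hX
  refine ⟨C, (X.union F).dist_le_mul_dist X (fun a => a.left) C ?_⟩
  rintro a _ (⟨x, hx, rfl⟩ | ⟨φ, rfl⟩)
  · simp only [SemidirectProduct.mul_left, SemidirectProduct.left_inl]
    rw [X.dist_mul]
    exact hC _ a.right.2 x hx
  · simp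

theorem GenSet.IsCoarselyInvariant.exists_isQIEmbedding_left {G : Type*} [Group G] {X : GenSet G}
    {F : Subgroup (MulAut G)} (hX : X.IsCoarselyInvariant F) :
    ∃ K : ℝ, IsQIEmbedding (M := Cayl (X.union F)) (N := Cayl X) K
      (fun a : AutSemidirect F => a.left) := by
  obtain ⟨C, hC⟩ := hX.exists_dist_left_le
  refine (X.union F).exists_isQIEmbedding X _ C 2 hC fun a b => ?_
  have := X.dist_union_le F a b
  omega

theorem GenSet.IsCoarselyInvariant.exists_isQIEmbedding_inl {G : Type*} [Group G] {X : GenSet G}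
    {F : Subgroup (MulAut G)} (hX : X.IsCoarselyInvariant F) :
    ∃ K : ℝ, IsQIEmbedding (M := Cayl X) (N := Cayl (X.union F)) K
      (SemidirectProduct.inl : G →* AutSemidirect F) := by
  obtain ⟨C, hC⟩ := hX.exists_dist_left_le
  refine X.exists_isQIEmbedding (X.union F) _ 1 C (fun a b => ?_) (fun a b => ?_)
  · rw [GenSet.dist_eq_wordLength, X.dist_eq_wordLength, ← map_inv, ← map_mul, one_mul]
    exact X.wordLength_union_inl_le F _
  · exact (hC (SemidirectProduct.inl a) (SemidirectProduct.inl b)).trans (Nat.le_add_right _ _)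

theorem GenSet.IsCoarselyInvariant.gromovHyperbolic_union {G : Type*} [Group G] {X : GenSet G}
    {F : Subgroup (MulAut G)} (hX : X.IsCoarselyInvariant F) [GromovHyperbolic (Cayl X)] :
    GromovHyperbolic (Cayl (X.union F)) := by
  obtain ⟨K, hK⟩ := hX.exists_isQIEmbedding_left
  exact hK.gromovHyperbolic (Cayl.isGraphLike _) (Cayl.isGraphLike _)

theorem GenSet.IsCoarselyInvariant.le_of_union_le {G : Type*} [Group G] {X Y : GenSet G}
    {F : Subgroup (MulAut G)} (hX : X.IsCoarselyInvariant F) (h : X.union F ≤ Y.union F) :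
    X ≤ Y := by
  obtain ⟨C, hC⟩ := hX.exists_dist_left_le
  obtain ⟨D, hD⟩ := h
  refine ⟨C * D, fun y hy => ?_⟩
  exact (hC 1 (SemidirectProduct.inl y)).trans
    (Nat.mul_le_mul_left C (hD _ (Or.inl ⟨y, hy, rfl⟩)))

/-! ### Generating sets of the semidirect product -/

/-- The subset `G ∩ F Z F` of `G`, for a subset `Z` of `G ⋊ F`. -/
def restrictSet {G : Type*} [Group G] {F : Subgroup (MulAut G)} (Z : Set (AutSemidirect F)) :
    Set G :=
  {g | ∃ φ ψ : F, ∃ z ∈ Z, SemidirectProduct.inl g =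
    (SemidirectProduct.inr φ * z * SemidirectProduct.inr ψ : AutSemidirect F)}

theorem apply_mem_restrictSet {G : Type*} [Group G] {F : Subgroup (MulAut G)}
    {Z : Set (AutSemidirect F)} (φ : F) {g : G} (hg : g ∈ restrictSet Z) :
    φ.1 g ∈ restrictSet Z := by
  obtain ⟨φ', ψ, z, hz, h⟩ := hg
  refine ⟨φ * φ', ψ * φ⁻¹, z, hz, ?_⟩
  have h' := SemidirectProduct.inl_aut (φ := F.subtype) φ g
  rw [h, Subgroup.subtype_apply] at h'
  rw [h']
  simp only [map_mul, mul_assoc]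

theorem left_mem_restrictSet {G : Type*} [Group G] {F : Subgroup (MulAut G)}
    {Z : Set (AutSemidirect F)} {z : AutSemidirect F} (hz : z ∈ Z) : z.left ∈ restrictSet Z := by
  refine ⟨1, z.right⁻¹, z, hz, ?_⟩
  rw [map_one, one_mul, map_inv, eq_mul_inv_iff_mul_eq, SemidirectProduct.inl_left_mul_inr_right]

/-- The generating set `G ∩ F Z F` of `G`, for a generating set `Z` of `G ⋊ F`. -/
def GenSet.restrict {G : Type*} [Group G] {F : Subgroup (MulAut G)}
    (Z : GenSet (AutSemidirect F)) : GenSet G where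
  carrier := restrictSet Z.carrier
  generates := by
    have hinv : ∀ φ : F, ∀ g ∈ Subgroup.closure (restrictSet Z.carrier),
        φ.1 g ∈ Subgroup.closure (restrictSet Z.carrier) := by
      intro φ g hg
      induction hg using Subgroup.closure_induction with
      | mem x hx => exact Subgroup.subset_closure (apply_mem_restrictSet φ hx)
      | one => rw [map_one]; exact one_mem _
      | mul x y _ _ hx hy => rw [map_mul]; exact mul_mem hx hy
      | inv x _ hx => rw [map_inv]; exact inv_mem hx
    -- Every element of `G ⋊ F` has its `G`-component in the `F`-invariant subgroup generated by
    -- `G ∩ F Z F`, since this holds for the elements of `Z`.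
    have hleft : ∀ h ∈ Subgroup.closure Z.carrier,
        h.left ∈ Subgroup.closure (restrictSet Z.carrier) := by
      intro h hh
      induction hh using Subgroup.closure_induction with
      | mem z hz => exact Subgroup.subset_closure (left_mem_restrictSet hz)
      | one => exact one_mem _
      | mul x y _ _ hx hy =>
        rw [SemidirectProduct.mul_left]
        exact mul_mem hx (hinv _ _ hy)
      | inv x _ hx =>
        rw [SemidirectProduct.inv_left]
        exact hinv x.right⁻¹ _ (inv_mem hx)
    rw [eq_top_iff]
    intro g _
    exact hleft (SemidirectProduct.inl g) (by rw [Z.generates]; trivial)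

theorem GenSet.map_restrict {G : Type*} [Group G] {F : Subgroup (MulAut G)}
    (Z : GenSet (AutSemidirect F)) {φ : MulAut G} (hφ : φ ∈ F) :
    Z.restrict.map φ = Z.restrict := by
  have hc : (Z.restrict.map φ).carrier = Z.restrict.carrier := by
    refine Set.Subset.antisymm ?_ fun g hg => ?_
    · rintro _ ⟨g, hg, rfl⟩
      exact apply_mem_restrictSet ⟨φ, hφ⟩ hg
    · exact ⟨φ⁻¹ g, apply_mem_restrictSet ⟨φ⁻¹, inv_mem hφ⟩ hg, MulAut.apply_inv_self _ _ _⟩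
  cases hZ : Z.restrict.map φ
  cases hZ' : Z.restrict
  rw [hZ, hZ'] at hc
  simpa using hc

theorem GenSet.union_restrict_le {G : Type*} [Group G] {F : Subgroup (MulAut G)}
    (Z : GenSet (AutSemidirect F)) : Z.restrict.union F ≤ Z := by
  refine ⟨2, fun z hz => ?_⟩
  rw [← SemidirectProduct.inl_left_mul_inr_right z]
  exact (GenSet.wordLength_mul_le _ _ _).trans (Nat.add_le_add
    (GenSet.wordLength_le_of_mem _ (Or.inl ⟨_, left_mem_restrictSet hz, rfl⟩))
    (GenSet.wordLength_union_inr_le _ F _))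

theorem GenSet.le_union_restrict {G : Type*} [Group G] {F : Subgroup (MulAut G)} [Finite F]
    (Z : GenSet (AutSemidirect F)) : Z ≤ Z.restrict.union F := by
  obtain ⟨C, hC⟩ := (Set.finite_range
    (fun φ : F => Z.wordLength (SemidirectProduct.inr φ : AutSemidirect F))).bddAbove
  have hC : ∀ φ : F, Z.wordLength (SemidirectProduct.inr φ : AutSemidirect F) ≤ C :=
    fun φ => hC ⟨φ, rfl⟩
  refine ⟨C + 1 + C, ?_⟩
  rintro _ (⟨g, ⟨φ, ψ, z, hz, h⟩, rfl⟩ | ⟨φ, rfl⟩)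
  · rw [h]
    exact (Z.wordLength_mul_le _ _).trans (add_le_add ((Z.wordLength_mul_le _ _).trans
      (add_le_add (hC φ) (Z.wordLength_le_of_mem hz))) (hC ψ))
  · exact (hC φ).trans (by omega)

theorem GenSet.isCoarselyInvariant_restrict {G : Type*} [Group G] {F : Subgroup (MulAut G)}
    (Z : GenSet (AutSemidirect F)) : Z.restrict.IsCoarselyInvariant F := by
  exact ⟨1, fun φ hφ x hx => Z.restrict.wordLength_le_of_mem
    (apply_mem_restrictSet ⟨φ, hφ⟩ hx)⟩

theorem GenSet.gromovHyperbolic_restrict {G : Type*} [Group G] {F : Subgroup (MulAut G)}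
    [Finite F] (Z : GenSet (AutSemidirect F)) [GromovHyperbolic (Cayl Z)] :
    GromovHyperbolic (Cayl Z.restrict) := by
  obtain ⟨K, hK⟩ := GenSet.exists_isQIEmbedding_id Z.union_restrict_le Z.le_union_restrict
  have := hK.gromovHyperbolic (Cayl.isGraphLike _) (Cayl.isGraphLike _)
  obtain ⟨K', hK'⟩ := Z.isCoarselyInvariant_restrict.exists_isQIEmbedding_inl
  exact hK'.gromovHyperbolic (Cayl.isGraphLike _) (Cayl.isGraphLike _)

theorem HypGenSet.hasLabel_iff_of_union {G : Type*} [Group G] {F : Subgroup (MulAut G)} [Finite F]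
    (X : HypGenSet G) (hX : X.1.IsCoarselyInvariant F) (Y : HypGenSet (AutSemidirect F))
    (h : X.1.union F ≤ Y.1) (h' : Y.1 ≤ X.1.union F) (l : ActionLabel) :
    X.HasLabel l ↔ Y.HasLabel l := by
  obtain ⟨K, hK⟩ := hX.exists_isQIEmbedding_inl
  obtain ⟨K', hK'⟩ := GenSet.exists_isQIEmbedding_id h h'
  have : (SemidirectProduct.inl : G →* AutSemidirect F).range.FiniteIndex := by
    rw [SemidirectProduct.range_inl_eq_ker_rightHom]
    infer_instance
  have : Nonempty (Cayl X.1) := ⟨(1 : G)⟩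
  exact (hK'.comp hK).actionHasLabel_iff (Cayl.isGraphLike _) (Cayl.isGraphLike _)
    (SemidirectProduct.inl : G →* AutSemidirect F)
    (fun g x => map_mul (SemidirectProduct.inl : G →* AutSemidirect F) g x) l

/-! ### The isomorphism of posets -/

theorem proposition5p3 {G : Type*} [Group G] (F : Subgroup (MulAut G)) [Finite F] :
    ∃ Ψ : InvHypStructure F ≃o HypStructure (AutSemidirect F),
      -- `Ψ [X] = [X ∪ F]`, for every representative `X`
      (∀ (X : HypGenSet G) (hX : ∀ φ ∈ F, HypStructure.map φ X.toStructure = X.toStructure),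
        ∃ hXF : GromovHyperbolic (Cayl (X.1.union F)),
          Ψ ⟨X.toStructure, hX⟩ = HypGenSet.toStructure ⟨X.1.union F, hXF⟩) ∧
      -- all representatives of `[X]` and of `Ψ [X]` have the same labels
      (∀ (X : HypGenSet G) (hX : ∀ φ ∈ F, HypStructure.map φ X.toStructure = X.toStructure)
        (Y : HypGenSet (AutSemidirect F)), Ψ ⟨X.toStructure, hX⟩ = Y.toStructure →
          ∀ l : ActionLabel, X.HasLabel l ↔ Y.HasLabel l) := by
  -- Choose a representative of every invariant structure.
  let rep : InvHypStructure F → HypGenSet G := fun x => ofAntisymmetrization (· ≤ ·) x.1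
  have hrep : ∀ x, (rep x).toStructure = x.1 := fun x =>
    toAntisymmetrization_ofAntisymmetrization _ _
  have hrepinv : ∀ x, (rep x).1.IsCoarselyInvariant F := fun x =>
    HypGenSet.isCoarselyInvariant F (rep x) (by rw [hrep]; exact x.2)
  have hhyp : ∀ x, GromovHyperbolic (Cayl ((rep x).1.union F)) := fun x =>
    (hrepinv x).gromovHyperbolic_union
  let ψ : InvHypStructure F → HypStructure (AutSemidirect F) := fun x =>
    HypGenSet.toStructure ⟨(rep x).1.union F, hhyp x⟩
  have hle : ∀ x y, ψ x ≤ ψ y ↔ x ≤ y := by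
    intro x y
    have h1 : ψ x ≤ ψ y ↔ (rep x).1.union F ≤ (rep y).1.union F :=
      toAntisymmetrization_le_toAntisymmetrization_iff
    have h2 : x ≤ y ↔ (rep x).1 ≤ (rep y).1 := by
      rw [← Subtype.coe_le_coe, ← hrep x, ← hrep y]
      exact toAntisymmetrization_le_toAntisymmetrization_iff
    rw [h1, h2]
    exact ⟨(hrepinv x).le_of_union_le, GenSet.union_mono F⟩
  have hval : ∀ (X : HypGenSet G)
      (hX : ∀ φ ∈ F, HypStructure.map φ X.toStructure = X.toStructure)
      (hXF : GromovHyperbolic (Cayl (X.1.union F))),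
      ψ ⟨X.toStructure, hX⟩ = HypGenSet.toStructure ⟨X.1.union F, hXF⟩ := by
    intro X hX hXF
    have h := hrep ⟨X.toStructure, hX⟩
    apply le_antisymm
    · exact toAntisymmetrization_le_toAntisymmetrization_iff.mpr
        (GenSet.union_mono F (toAntisymmetrization_le_toAntisymmetrization_iff.mp h.le))
    · exact toAntisymmetrization_le_toAntisymmetrization_iff.mpr
        (GenSet.union_mono F (toAntisymmetrization_le_toAntisymmetrization_iff.mp h.ge))
  have hsurj : Function.Surjective ψ := by
    intro y
    induction y using Antisymmetrization.ind with
    | _ Z =>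
      have hyp := Z.1.gromovHyperbolic_restrict
      let X : HypGenSet G := ⟨Z.1.restrict, hyp⟩
      have hX : ∀ φ ∈ F, HypStructure.map φ X.toStructure = X.toStructure := fun φ hφ =>
        congrArg (toAntisymmetrization (· ≤ ·))
          (Subtype.ext (Z.1.map_restrict hφ) : HypGenSet.map φ X = X)
      have hXF := (HypGenSet.isCoarselyInvariant F X hX).gromovHyperbolic_union
      refine ⟨⟨X.toStructure, hX⟩, (hval X hX hXF).trans (le_antisymm ?_ ?_)⟩
      · exact toAntisymmetrization_le_toAntisymmetrization_iff.mpr Z.1.union_restrict_le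
      · exact toAntisymmetrization_le_toAntisymmetrization_iff.mpr Z.1.le_union_restrict
  let Ψ : InvHypStructure F ≃o HypStructure (AutSemidirect F) :=
    RelIso.ofSurjective (OrderEmbedding.ofMapLEIff ψ hle) hsurj
  refine ⟨Ψ, fun X hX => ?_, fun X hX Y hY l => ?_⟩
  · exact ⟨(HypGenSet.isCoarselyInvariant F X hX).gromovHyperbolic_union, hval X hX _⟩
  · have hinv := HypGenSet.isCoarselyInvariant F X hX
    have hXY := (hval X hX hinv.gromovHyperbolic_union).symm.trans hY
    exact X.hasLabel_iff_of_union hinv Y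
      (toAntisymmetrization_le_toAntisymmetrization_iff.mp hXY.le)
      (toAntisymmetrization_le_toAntisymmetrization_iff.mp hXY.ge) l
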